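/- Let $n$ be an odd positive integer, let $w$ be a braid on $n$ strands, and let $w^*$ be its mirror image, i.e. the braid obtained from $w$ by reversing all crossings ($*$ is the automorphism of the braid group $B_n$ with $\sigma_i\mapsto\sigma_i^{-1}$). Let $m\ge 0$, and suppose that the closure of the braid $(ww^*)^{2^m}$ is a knot $K$. Let $C_K(z)\in\mathbb Z[z]$ be the Conway polynomial of $K$, i.e. the polynomial with $C_K(0)=1$ for which $C_K(\sqrt t-1/\sqrt t)$ is the Alexander polynomial of $K$ up to a unit $\pm t^k$. Then there is a polynomial $f\in\mathbb Z_4[z]$ (where $\mathbb Z_4=\mathbb Z/4\mathbb Z$) with $$C_K(z)\equiv f(z)f(-z)\pmod 4 .$$ -/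

import Mathlib

open scoped LaurentPolynomial Polynomial

/-! ### Artin's braid group and the mirror image of a braid -/

/-- The defining relators of the braid group on `n` strands; the generator `σ_i`, with
`i = 0, …, n - 2`, exchanges the strands at the positions `i` and `i + 1`. -/
inductive BraidRelator (n : ℕ) : FreeGroup (Fin (n - 1)) → Prop
  /-- `σ_i σ_j = σ_j σ_i` for `|i - j| ≥ 2`. -/
  | comm (i j : Fin (n - 1)) (h : (i : ℕ) + 2 ≤ j) :
      BraidRelator n (.of i * .of j * (.of j * .of i)⁻¹)
  /-- `σ_i σ_{i+1} σ_i = σ_{i+1} σ_i σ_{i+1}`. -/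
  | braid (i j : Fin (n - 1)) (h : (i : ℕ) + 1 = j) :
      BraidRelator n (.of i * .of j * .of i * (.of j * .of i * .of j)⁻¹)

/-- Artin's braid group on `n` strands. -/
abbrev BraidGroup (n : ℕ) : Type := PresentedGroup {r | BraidRelator n r}

namespace BraidGroup

/-- The standard generator `σ_i`. -/
def σ {n : ℕ} (i : Fin (n - 1)) : BraidGroup n := PresentedGroup.of i

lemma σ_comm {n : ℕ} (i j : Fin (n - 1)) (h : (i : ℕ) + 2 ≤ j) :
    (σ i * σ j : BraidGroup n) = σ j * σ i := by
  have := PresentedGroup.one_of_mem (rels := {r | BraidRelator n r}) (BraidRelator.comm i j h)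
  rw [map_mul, map_inv, mul_inv_eq_one] at this
  simp only [map_mul] at this
  exact this

lemma σ_braid {n : ℕ} (i j : Fin (n - 1)) (h : (i : ℕ) + 1 = j) :
    (σ i * σ j * σ i : BraidGroup n) = σ j * σ i * σ j := by
  have := PresentedGroup.one_of_mem (rels := {r | BraidRelator n r}) (BraidRelator.braid i j h)
  rw [map_mul, map_inv, mul_inv_eq_one] at this
  simp only [map_mul] at this
  exact this

lemma mirror_aux {n : ℕ} : ∀ r ∈ {r | BraidRelator n r},
    FreeGroup.lift (fun i => (σ i : BraidGroup n)⁻¹) r = 1 := by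
  rintro r (⟨i, j, h⟩ | ⟨i, j, h⟩)
  · have := σ_comm i j h
    simp only [map_mul, map_inv, FreeGroup.lift_apply_of, mul_inv_eq_one]
    rw [← mul_inv_rev, ← mul_inv_rev, this]
  · have := σ_braid i j h
    simp only [map_mul, map_inv, FreeGroup.lift_apply_of, mul_inv_eq_one]
    rw [← mul_inv_rev, ← mul_inv_rev, ← mul_inv_rev, ← mul_inv_rev, ← mul_assoc, ← mul_assoc,
      this]

/-- The mirror image `w*` of a braid `w`: all crossings are reversed, that is, `*` is the
automorphism of the braid group that sends each `σ_i` to `σ_i⁻¹`. -/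
def mirror {n : ℕ} : BraidGroup n →* BraidGroup n := PresentedGroup.toGroup mirror_aux

end BraidGroup

/-- Braid words on `n` strands: the letter `(i, true)` stands for `σ_i`, the letter `(i, false)`
for `σ_i⁻¹`. -/
abbrev BraidWord (n : ℕ) : Type := List (Fin (n - 1) × Bool)

/-- The braid that a braid word represents. -/
def BraidWord.toBraid {n : ℕ} (v : BraidWord n) : BraidGroup n :=
  PresentedGroup.mk {r | BraidRelator n r} (FreeGroup.mk v)

/-! ### Oriented link diagrams, knots, Alexander and Conway polynomials -/

/-- A vertex of an oriented link diagram whose set of (oriented) edges is `E`. -/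
inductive DiagramVertex (E : Type) : Type
  /-- A point at which the edge `e` is continued by the edge `f`, without a crossing. -/
  | joint (e f : E) : DiagramVertex E
  /-- A crossing, of sign `+` (`positive = true`) or `-` (`positive = false`): the upper strand
  comes in along `overIn` and leaves along `overOut`, the lower strand comes in along `underIn` and
  leaves along `underOut`. -/
  | crossing (positive : Bool) (overIn overOut underIn underOut : E) : DiagramVertex E

/-- The combinatorial data of an oriented link diagram with the set of edges `E`. -/
structure LinkDiagram (E : Type) : Type where
  /-- The crossings, and the points at which two edges meet without a crossing. -/
  vertices : Set (DiagramVertex E)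

/-- `v.Next e f`: somebody who travels along the link and arrives at the vertex `v` along the edge
`e` leaves it along the edge `f`. -/
inductive DiagramVertex.Next {E : Type} : DiagramVertex E → E → E → Prop
  | joint (e f : E) : (DiagramVertex.joint e f).Next e f
  | over (s : Bool) (a b c d : E) : (DiagramVertex.crossing s a b c d).Next a b
  | under (s : Bool) (a b c d : E) : (DiagramVertex.crossing s a b c d).Next c d

/-- The relations which a vertex imposes on the generators `x_e` of the Alexander module (the
generators `x_e` stand for the meridians of the edges). They are the Fox derivatives of the
Wirtinger relations, abelianized by sending all meridians to `t = T 1`: the two edges of an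
upper strand `o` have the same meridian, and for a lower strand that goes from `u` to `u'` the
relation is `u' = o u o⁻¹` at a positive and `u = o u' o⁻¹` at a negative crossing. -/
noncomputable def DiagramVertex.relations {E : Type} [DecidableEq E] :
    DiagramVertex E → Set (E → ℤ[T;T⁻¹])
  | .joint e f => {Pi.single f 1 - Pi.single e 1}
  | .crossing true a b c d =>
      {Pi.single b 1 - Pi.single a 1,
        Pi.single d 1 - (Pi.single a (1 - LaurentPolynomial.T 1) +
          Pi.single c (LaurentPolynomial.T 1))}
  | .crossing false a b c d =>
      {Pi.single b 1 - Pi.single a 1,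
        Pi.single c 1 - (Pi.single a (1 - LaurentPolynomial.T 1) +
          Pi.single d (LaurentPolynomial.T 1))}

namespace LinkDiagram

/-- The diagram represents a knot, i.e. a link with exactly one component: it is not empty, and
from every edge one arrives at every other one by travelling along the link. -/
def IsKnot {E : Type} (D : LinkDiagram E) : Prop :=
  Nonempty E ∧ ∀ e f : E, Relation.ReflTransGen (fun a b => ∃ v ∈ D.vertices, v.Next a b) e f

variable {E : Type} [Fintype E] [DecidableEq E]

/-- The Alexander ideal of a diagram: the first elementary ideal of the link group, generated by
the minors of order `#E - 1` of its Alexander matrix. The columns of this matrix are indexed by the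
edges, its rows are the relations at the vertices. -/
noncomputable def alexanderIdeal (D : LinkDiagram E) : Ideal ℤ[T;T⁻¹] :=
  Ideal.span {d | ∃ (r : Fin (Fintype.card E - 1) → E → ℤ[T;T⁻¹])
      (c : Fin (Fintype.card E - 1) → E),
    (∀ i, ∃ v ∈ D.vertices, r i ∈ v.relations) ∧ d = (Matrix.of fun i j => r i (c j)).det}

/-- `Δ` is an Alexander polynomial of the diagram: it generates the Alexander ideal. (So `Δ` is
determined only up to multiplication by units `± t ^ k`.) -/
def IsAlexanderPolynomial (D : LinkDiagram E) (Δ : ℤ[T;T⁻¹]) : Prop :=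
  D.alexanderIdeal = Ideal.span {Δ}

end LinkDiagram

/-- The substitution `t = s²`; so `s` is the square root of `t`. -/
noncomputable def substSq : ℤ[T;T⁻¹] →+* ℤ[T;T⁻¹] :=
  LaurentPolynomial.eval₂ LaurentPolynomial.C (LaurentPolynomial.isUnit_T (R := ℤ) 2).unit

/-- The substitution `z = s - s⁻¹`, i.e. `z = √t - 1 / √t`. -/
noncomputable def substConway : ℤ[X] →+* ℤ[T;T⁻¹] :=
  Polynomial.eval₂RingHom LaurentPolynomial.C (LaurentPolynomial.T 1 - LaurentPolynomial.T (-1))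

/-- `C` is the Conway polynomial of the knot with diagram `D`: for `z = √t - 1 / √t` it is the
Alexander polynomial, normalized by `C(0) = 1`. -/
def LinkDiagram.IsConwayPolynomial {E : Type} [Fintype E] [DecidableEq E] (D : LinkDiagram E)
    (C : ℤ[X]) : Prop :=
  (∃ Δ : ℤ[T;T⁻¹], D.IsAlexanderPolynomial Δ ∧ substConway C = substSq Δ) ∧ C.eval 0 = 1

/-! ### The Conway polynomial is unique -/

lemma LaurentPolynomial.exists_eq_of_isUnit {u : ℤ[T;T⁻¹]} (hu : IsUnit u) :
    ∃ (ε : ℤ) (k : ℤ), u = LaurentPolynomial.C ε * LaurentPolynomial.T k := by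
  obtain ⟨w, hw⟩ := hu.exists_right_inv
  obtain ⟨n, f, hf⟩ := LaurentPolynomial.exists_T_pow u
  obtain ⟨m, g, hg⟩ := LaurentPolynomial.exists_T_pow w
  have h : f * g = Polynomial.X ^ (n + m) := by
    apply Polynomial.toLaurent_injective
    rw [map_mul, hf, hg, Polynomial.toLaurent_X_pow, Nat.cast_add, LaurentPolynomial.T_add]
    linear_combination (LaurentPolynomial.T n * LaurentPolynomial.T m) * hw
  obtain ⟨j, -, v, hv⟩ := (dvd_prime_pow Polynomial.prime_X _).1 (Dvd.intro g h)
  obtain ⟨ε, -, hε⟩ := Polynomial.isUnit_iff.1 (v⁻¹).isUnit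
  refine ⟨ε, j - n, ?_⟩
  have hf' : f = Polynomial.C ε * Polynomial.X ^ j := by
    rw [hε, ← hv, mul_comm, mul_assoc, Units.mul_inv, mul_one]
  have h3 : u * LaurentPolynomial.T n = LaurentPolynomial.C ε * LaurentPolynomial.T j := by
    rw [← hf, hf', Polynomial.toLaurent_C_mul_X_pow]
  rw [LaurentPolynomial.T_sub, ← mul_assoc, ← h3, mul_assoc, ← LaurentPolynomial.T_add]
  simp

lemma LaurentPolynomial.coe_unit_T_zpow (i j : ℤ) :
    (((LaurentPolynomial.isUnit_T (R := ℤ) i).unit ^ j : ℤ[T;T⁻¹]ˣ) : ℤ[T;T⁻¹]) =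
      LaurentPolynomial.T (i * j) := by
  have : LaurentPolynomial.eval₂ LaurentPolynomial.C (LaurentPolynomial.isUnit_T (R := ℤ) i).unit
      (LaurentPolynomial.T j) = LaurentPolynomial.T (i * j) := by
    obtain ⟨a, rfl | rfl⟩ := j.eq_nat_or_neg
    · rw [LaurentPolynomial.eval₂_T_n, IsUnit.unit_spec, LaurentPolynomial.T_pow, mul_comm]
    · have h : LaurentPolynomial.T i ^ a *
          LaurentPolynomial.eval₂ LaurentPolynomial.C
            (LaurentPolynomial.isUnit_T (R := ℤ) i).unit (LaurentPolynomial.T (-a)) = 1 := by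
        rw [LaurentPolynomial.eval₂_T_neg_n, ← mul_pow, IsUnit.mul_val_inv, one_pow]
      have h2 : (LaurentPolynomial.T i ^ a : ℤ[T;T⁻¹]) * LaurentPolynomial.T (i * -a) = 1 := by
        rw [LaurentPolynomial.T_pow, ← LaurentPolynomial.T_add, ← LaurentPolynomial.T_zero]
        congr 1
        ring
      exact ((LaurentPolynomial.isUnit_T i).pow a).mul_left_cancel (h.trans h2.symm)
  rw [← this, LaurentPolynomial.eval₂_T]

lemma substConway_eval_one (C : ℤ[X]) :
    LaurentPolynomial.eval₂ (Int.castRingHom ℤ) 1 (substConway C) = C.eval 0 := by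
  have : (LaurentPolynomial.eval₂ (Int.castRingHom ℤ) (1 : ℤˣ)).comp substConway
      = Polynomial.evalRingHom 0 := by
    apply Polynomial.ringHom_ext <;> simp [substConway, -LaurentPolynomial.eval₂_C]
  exact congrArg (fun φ => φ C) this

lemma substConway_injective {P : ℤ[X]} (h : substConway P = 0) : P = 0 := by
  have key (y : ℝ) : (P.map (Int.castRingHom ℝ)).eval y = 0 := by
    -- choose `s > 0` with `s - s⁻¹ = y`
    have hpos : 0 < (y + √(y ^ 2 + 4)) / 2 := by
      have : |y| < √(y ^ 2 + 4) := by
        rw [← Real.sqrt_sq_eq_abs]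
        exact Real.sqrt_lt_sqrt (sq_nonneg y) (by linarith)
      linarith [neg_abs_le y]
    have hs : (y + √(y ^ 2 + 4)) / 2 - ((y + √(y ^ 2 + 4)) / 2)⁻¹ = y := by
      have h4 : √(y ^ 2 + 4) ^ 2 = y ^ 2 + 4 := Real.sq_sqrt (by positivity)
      generalize √(y ^ 2 + 4) = q at *
      have : y + q ≠ 0 := by linarith
      field_simp
      linear_combination h4
    generalize (y + √(y ^ 2 + 4)) / 2 = s at *
    have hc : (LaurentPolynomial.eval₂ (Int.castRingHom ℝ) (Units.mk0 s hpos.ne')).comp substConway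
        = Polynomial.eval₂RingHom (Int.castRingHom ℝ) y := by
      apply Polynomial.ringHom_ext
      · simp
      · simp only [substConway, RingHom.comp_apply, Polynomial.coe_eval₂RingHom,
          Polynomial.eval₂_X, map_sub, LaurentPolynomial.eval₂_T, zpow_one, zpow_neg,
          Units.val_inv_eq_inv_val, Units.val_mk0, hs]
    have := congrArg (fun φ => φ P) hc
    simp only [RingHom.comp_apply, h, map_zero, Polynomial.coe_eval₂RingHom] at this
    rw [Polynomial.eval_map, ← this]
  have : P.map (Int.castRingHom ℝ) = 0 := Polynomial.funext fun y => by simp [key]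
  exact (Polynomial.map_eq_zero_iff (Int.cast_injective (α := ℝ))).1 this

/-- A knot has at most one Conway polynomial. -/
theorem LinkDiagram.IsConwayPolynomial.unique {E : Type} [Fintype E] [DecidableEq E]
    {D : LinkDiagram E} {C C' : ℤ[X]} (h : D.IsConwayPolynomial C)
    (h' : D.IsConwayPolynomial C') : C = C' := by
  obtain ⟨⟨Δ, hΔ, hC⟩, h0⟩ := h
  obtain ⟨⟨Δ', hΔ', hC'⟩, h0'⟩ := h'
  obtain ⟨u, hu⟩ := Ideal.span_singleton_eq_span_singleton.1 (hΔ.symm.trans hΔ')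
  obtain ⟨ε, k, hk⟩ := LaurentPolynomial.exists_eq_of_isUnit u.isUnit
  -- the two polynomials differ by a unit `ε * t ^ k`
  have hT (j : ℤ) : substSq (LaurentPolynomial.T j) = LaurentPolynomial.T (2 * j) := by
    rw [substSq, LaurentPolynomial.eval₂_T]
    exact LaurentPolynomial.coe_unit_T_zpow 2 j
  have e1 : substConway C' =
      substConway C * (LaurentPolynomial.C ε * LaurentPolynomial.T (2 * k)) := by
    rw [hC', ← hu, map_mul, ← hC, hk, map_mul, hT]
    simp [substSq]
  have hε : ε = 1 := by
    have := congrArg (LaurentPolynomial.eval₂ (Int.castRingHom ℤ) (1 : ℤˣ)) e1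
    rw [map_mul, map_mul, substConway_eval_one, substConway_eval_one, h0, h0',
      LaurentPolynomial.eval₂_C, LaurentPolynomial.eval₂_T] at this
    simpa using this.symm
  subst hε
  -- the substitution `s ↦ -s⁻¹` fixes `z`
  let x : ℤ[T;T⁻¹]ˣ := -(LaurentPolynomial.isUnit_T (R := ℤ) (-1)).unit
  have hx (j : ℤ) : ((x ^ (2 * j) : ℤ[T;T⁻¹]ˣ) : ℤ[T;T⁻¹]) = LaurentPolynomial.T (-(2 * j)) := by
    rw [show x ^ (2 * j) = ((LaurentPolynomial.isUnit_T (R := ℤ) (-1)).unit) ^ (2 * j) from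
      Even.neg_zpow (even_two_mul j) _, LaurentPolynomial.coe_unit_T_zpow]
    congr 1
    ring
  have hφ (P : ℤ[X]) :
      LaurentPolynomial.eval₂ LaurentPolynomial.C x (substConway P) = substConway P := by
    have : (LaurentPolynomial.eval₂ LaurentPolynomial.C x).comp substConway = substConway := by
      apply Polynomial.ringHom_ext
      · simp [substConway]
      · have hx1 : (x : ℤ[T;T⁻¹]) = -LaurentPolynomial.T (-1) := rfl
        have hxi : ((x⁻¹ : ℤ[T;T⁻¹]ˣ) : ℤ[T;T⁻¹]) = -LaurentPolynomial.T 1 := by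
          rw [Units.inv_eq_of_mul_eq_one_right (a := -LaurentPolynomial.T 1)]
          rw [hx1, neg_mul_neg, ← LaurentPolynomial.T_add, neg_add_cancel, LaurentPolynomial.T_zero]
        simp only [substConway, RingHom.comp_apply, Polynomial.coe_eval₂RingHom,
          Polynomial.eval₂_X, map_sub, LaurentPolynomial.eval₂_T, zpow_one, zpow_neg, hxi, hx1]
        ring
    exact congrArg (fun φ => φ P) this
  have e2 := congrArg (LaurentPolynomial.eval₂ LaurentPolynomial.C x) e1
  rw [map_mul, hφ, hφ, map_mul, LaurentPolynomial.eval₂_C, LaurentPolynomial.eval₂_T, hx, e1,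
    map_one, one_mul, one_mul] at e2
  have hC0 : substConway C ≠ 0 := by
    intro h
    have := substConway_eval_one C
    rw [h, map_zero, h0] at this
    exact zero_ne_one this
  have hk0 : k = 0 := by
    have h1 := congrArg LaurentPolynomial.degree (mul_left_cancel₀ hC0 e2)
    rw [LaurentPolynomial.degree_T, LaurentPolynomial.degree_T] at h1
    have h2 : 2 * k = -(2 * k) := by exact_mod_cast h1
    omega
  subst hk0
  have e3 : substConway (C' - C) = 0 := by
    rw [map_sub, e1]
    simp
  exact (sub_eq_zero.1 (substConway_injective e3)).symm

/-! ### The closure of a braid -/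

/-- The vertices of the diagram of the closure of the braid word `v`. The diagram has the `n`
edges `(p, k)` at each of the levels `k = 0, …, L`, where `L` is the length of `v`, and `(p, k)` is
the edge at the position `p`; the `k`-th letter of `v` connects the levels `k` and `k + 1`, and the
ends of the braid at the level `L` are joined to those at the level `0`. All strands run upwards. -/
inductive BraidWord.ClosureVertex {n : ℕ} (v : BraidWord n) :
    DiagramVertex (Fin n × Fin (v.length + 1)) → Prop
  /-- The braid is closed up. -/
  | close (p : Fin n) : ClosureVertex v (.joint (p, Fin.last _) (p, 0))
  /-- A strand that takes no part in the `k`-th crossing. -/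
  | straight (k : Fin v.length) (p : Fin n) (h : (p : ℕ) ≠ (v.get k).1)
      (h' : (p : ℕ) ≠ (v.get k).1 + 1) : ClosureVertex v (.joint (p, k.castSucc) (p, k.succ))
  /-- The letter `σ_i`: the strand from the position `p = i` to the position `q = i + 1` passes over
  the strand from `q` to `p`. -/
  | positive (k : Fin v.length) (p q : Fin n) (hp : (p : ℕ) = (v.get k).1)
      (hq : (q : ℕ) = (v.get k).1 + 1) (h : (v.get k).2 = true) :
      ClosureVertex v
        (.crossing true (p, k.castSucc) (q, k.succ) (q, k.castSucc) (p, k.succ))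
  /-- The letter `σ_i⁻¹`: the strand from the position `p = i` to the position `q = i + 1` passes
  under the strand from `q` to `p`. -/
  | negative (k : Fin v.length) (p q : Fin n) (hp : (p : ℕ) = (v.get k).1)
      (hq : (q : ℕ) = (v.get k).1 + 1) (h : (v.get k).2 = false) :
      ClosureVertex v
        (.crossing false (q, k.castSucc) (p, k.succ) (p, k.castSucc) (q, k.succ))

/-- The standard diagram of the closure of the braid that is given by a braid word. -/
def BraidWord.closure {n : ℕ} (v : BraidWord n) : LinkDiagram (Fin n × Fin (v.length + 1)) where
  vertices := {x | v.ClosureVertex x}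

/-! Put `t = s²` and let `J` be the tridiagonal form `burauForm`. The symmetrized reduced Burau
representation `ψ` satisfies `ψ_s(w)ᵀ J ψ_{1/s}(w) = J`, and reversing the crossings of `w` amounts
to `s ↦ s⁻¹`. For `M = ψ(w w*)` and `A = J ψ(w*)` this sesquilinear identity becomes the bilinear
one `Aᵀ M = A` (`transpose_burauForm_mul_mirror`), so `A` behaves like a Seifert matrix with
monodromy `M`. In particular `M` preserves `A`, and the powers of `M` have palindromic
characteristic polynomials. Their coefficients are polynomials in `z² = (s - s⁻¹)²`: they are
invariant under `s ↦ s⁻¹`, because `(w w*)*` is conjugate to `w w*`, and under `s ↦ -s`, which acts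
by conjugation.

The diagram enters through `det (1 - ψ(β)) = (1 + t + ⋯ + t^(n-1)) Δ`, where `Δ` generates the
Alexander ideal of the closure of `β` (`det_one_sub_burau`, `alexanderIdeal_closure`). After
symmetrization the first factor is the quantum integer `[n]`. For a knot, `Δ(1) = ±1`.

If `m = 0`, then `Aᵀ (1 - M) = Aᵀ - A` is skew-symmetric of even size `n - 1`, so its determinant is
a square. As `det A = ±[n] s^(2e)`, the Conway polynomial is up to sign a square of a polynomial in
`z²`.

If `m > 0`, then `det (1 - M^(2^m))` is the product of `det (1 - M)`, `det (1 + M)` and the `det (1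
+ M^(2^k))` with `0 < k < m`. A palindromic `P` of degree `2h` is `b X^h` modulo `X² + 1`, so the
last factors `P(i) P(-i) = b²` are squares; moreover `P(1) ≡ ±P(-1)` modulo 4, so `det (1 + M) ≡
±det (1 - M) = ±[n] C₀`. Dividing by `[n]`, the Conway polynomial is `±[n]` times a square modulo 4.
Finally `[n] = ±(a² - (z² + 4) b²) ≡ ±(a + z b)(a - z b)` with `a`, `b` polynomials in `z²`. The
total sign is `+`, because `-1` is not a square modulo 4. -/

/-! ### The symmetrized reduced Burau representation -/

section Burau

open Matrix

variable {R S : Type*} [CommRing R] [CommRing S]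

/-- The form that is preserved by the symmetrized reduced Burau representation. -/
def burauForm (N : ℕ) (s : Rˣ) : Matrix (Fin N) (Fin N) R :=
  Matrix.of fun i j => if i = j then (s : R) + (s⁻¹ : Rˣ)
    else if (i : ℕ) + 1 = j ∨ (j : ℕ) + 1 = i then -1 else 0

lemma burauForm_inv (N : ℕ) (s : Rˣ) : burauForm N s⁻¹ = burauForm N s := by
  ext i j
  simp [burauForm, add_comm]

lemma burauForm_transpose (N : ℕ) (s : Rˣ) : (burauForm N s)ᵀ = burauForm N s := by
  ext i j
  simp only [burauForm, transpose_apply, of_apply, eq_comm (a := j), or_comm]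

lemma burauForm_map (N : ℕ) (f : R →+* S) (s : Rˣ) :
    (burauForm N s).map f = burauForm N (Units.map (f : R →* S) s) := by
  ext i j
  simp only [burauForm, map_apply, of_apply, apply_ite f]
  simp [← map_inv]

/-- The idempotent-like generator `E_{ii} J` of the Temperley-Lieb algebra. -/
def temperleyLieb {N : ℕ} (s : Rˣ) (i : Fin N) : Matrix (Fin N) (Fin N) R :=
  Matrix.single i i 1 * burauForm N s

lemma temperleyLieb_inv {N : ℕ} (s : Rˣ) (i : Fin N) :
    temperleyLieb s⁻¹ i = temperleyLieb s i := by
  rw [temperleyLieb, burauForm_inv, temperleyLieb]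

/-- The factor `E_ii J E_jj` is `J_ij E_ij`, so all Temperley-Lieb relations can be read off from
the entries of `J`. -/
lemma temperleyLieb_mul {N : ℕ} (s : Rˣ) (i j : Fin N) :
    temperleyLieb s i * temperleyLieb s j =
      burauForm N s i j • (Matrix.single i j 1 * burauForm N s) := by
  rw [temperleyLieb, temperleyLieb, ← mul_assoc, single_mul_mul_single, ← Matrix.smul_mul,
    smul_single]
  simp

lemma temperleyLieb_mul_self {N : ℕ} (s : Rˣ) (i : Fin N) :
    temperleyLieb s i * temperleyLieb s i = ((s : R) + (s⁻¹ : Rˣ)) • temperleyLieb s i := by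
  rw [temperleyLieb_mul, temperleyLieb, burauForm, of_apply, if_pos rfl]

lemma temperleyLieb_mul_of_far {N : ℕ} (s : Rˣ) (i j : Fin N)
    (h : (i : ℕ) + 2 ≤ j ∨ (j : ℕ) + 2 ≤ i) :
    temperleyLieb s i * temperleyLieb s j = 0 := by
  rw [temperleyLieb_mul, burauForm, of_apply, if_neg (by rintro rfl; omega), if_neg (by omega),
    zero_smul]

lemma temperleyLieb_mul_mul {N : ℕ} (s : Rˣ) (i j : Fin N)
    (h : (i : ℕ) + 1 = j ∨ (j : ℕ) + 1 = i) :
    temperleyLieb s i * temperleyLieb s j * temperleyLieb s i = temperleyLieb s i := by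
  have h1 : burauForm N s i j = -1 := by
    rw [burauForm, of_apply, if_neg (by rintro rfl; omega), if_pos h]
  have h2 : burauForm N s j i = -1 := by
    rw [burauForm, of_apply, if_neg (by rintro rfl; omega), if_pos h.symm]
  rw [temperleyLieb_mul, h1, temperleyLieb, Matrix.smul_mul, ← mul_assoc, single_mul_mul_single, h2,
    ← Matrix.smul_mul, smul_single]
  simp

lemma temperleyLieb_apply {N : ℕ} (s : Rˣ) (i a b : Fin N) :
    temperleyLieb s i a b = if i = a then burauForm N s a b else 0 := by
  simp only [temperleyLieb, mul_apply, single_apply]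
  by_cases h : i = a <;> simp [h]

/-- The image of a generator under the symmetrized reduced Burau representation. -/
def burauGen {N : ℕ} (s : Rˣ) (i : Fin N) : (Matrix (Fin N) (Fin N) R)ˣ where
  val := 1 - (s : R) • temperleyLieb s i
  inv := 1 - ((s⁻¹ : Rˣ) : R) • temperleyLieb s i
  val_inv := by
    have h : (s : R) * ((s⁻¹ : Rˣ) * (s + (s⁻¹ : Rˣ))) = s + (s⁻¹ : Rˣ) := by simp [← mul_assoc]
    simp only [sub_mul, mul_sub, one_mul, mul_one, Matrix.smul_mul, Matrix.mul_smul,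
      temperleyLieb_mul_self, smul_smul, mul_left_comm ((s⁻¹ : Rˣ) : R), h]
    module
  inv_val := by
    have h : (s : R) * ((s⁻¹ : Rˣ) * (s + (s⁻¹ : Rˣ))) = s + (s⁻¹ : Rˣ) := by simp [← mul_assoc]
    simp only [sub_mul, mul_sub, one_mul, mul_one, Matrix.smul_mul, Matrix.mul_smul,
      temperleyLieb_mul_self, smul_smul, h]
    module

lemma burauGen_inv {N : ℕ} (s : Rˣ) (i : Fin N) : (burauGen s i)⁻¹ = burauGen s⁻¹ i := by
  ext1
  simp only [burauGen, temperleyLieb_inv]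
  rfl

lemma burauGen_comm {N : ℕ} (s : Rˣ) (i j : Fin N) (h : (i : ℕ) + 2 ≤ j) :
    burauGen s i * burauGen s j = burauGen s j * burauGen s i := by
  ext1
  simp only [burauGen, Units.val_mul, sub_mul, mul_sub, one_mul, mul_one, Matrix.smul_mul,
    Matrix.mul_smul, temperleyLieb_mul_of_far s i j (.inl h),
    temperleyLieb_mul_of_far s j i (.inr h)]
  module

/-- With `a² = (s + s⁻¹) a` and `a b a = a`, both sides expand to the symmetric expression `1 - s a
- s b + s² (a b + b a)`. -/
lemma burauGen_braid {N : ℕ} (s : Rˣ) (i j : Fin N) (h : (i : ℕ) + 1 = j) :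
    burauGen s i * burauGen s j * burauGen s i = burauGen s j * burauGen s i * burauGen s j := by
  ext1
  have h1 := temperleyLieb_mul_mul s i j (.inl h)
  have h2 := temperleyLieb_mul_mul s j i (.inr h)
  have h3 := temperleyLieb_mul_self s i
  have h4 := temperleyLieb_mul_self s j
  simp only [burauGen, Units.val_mul]
  generalize temperleyLieb s i = a at *
  generalize temperleyLieb s j = b at *
  have e : (s : R) * (s * (s + (s⁻¹ : Rˣ))) = s * s * s + s := by
    linear_combination (s : R) * s.mul_inv
  simp only [sub_mul, mul_sub, one_mul, mul_one, Matrix.smul_mul, Matrix.mul_smul, h1, h2, h3, h4,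
    smul_smul, e]
  module

/-- The symmetrized reduced Burau representation, with `t = s²`. -/
def burau (n : ℕ) (s : Rˣ) : BraidGroup n →* (Matrix (Fin (n - 1)) (Fin (n - 1)) R)ˣ :=
  PresentedGroup.toGroup (f := burauGen s) <| by
    rintro r (⟨i, j, h⟩ | ⟨i, j, h⟩)
    · simp only [map_mul, map_inv, FreeGroup.lift_apply_of, mul_inv_eq_one]
      exact burauGen_comm s i j h
    · simp only [map_mul, map_inv, FreeGroup.lift_apply_of, mul_inv_eq_one]
      exact burauGen_braid s i j h

lemma burau_σ {n : ℕ} (s : Rˣ) (i : Fin (n - 1)) :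
    burau n s (BraidGroup.σ i) = burauGen s i :=
  PresentedGroup.toGroup.of _

lemma burauGen_map {N : ℕ} (f : R →+* S) (s : Rˣ) (i : Fin N) :
    (burauGen s i).val.map f = (burauGen (Units.map (f : R →* S) s) i).val := by
  simp only [burauGen, temperleyLieb, ← burauForm_map]
  rw [← RingHom.mapMatrix_apply, map_sub, map_one, RingHom.mapMatrix_apply, Matrix.map_smul' _ _ _
    (map_mul f), Matrix.map_mul, map_single]
  simp

lemma burau_map {n : ℕ} (f : R →+* S) (s : Rˣ) (w : BraidGroup n) :
    (burau n s w).val.map f = (burau n (Units.map (f : R →* S) s) w).val := by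
  have : (Units.map (f.mapMatrix (m := Fin (n - 1))).toMonoidHom).comp (burau n s) =
      burau n (Units.map (f : R →* S) s) := by
    refine PresentedGroup.ext fun i => Units.ext ?_
    change (burau n s (BraidGroup.σ i)).val.map f = (burau n _ (BraidGroup.σ i)).val
    rw [burau_σ, burau_σ, burauGen_map]
  exact congrArg (fun g => (g w).val) this

/-- The form does not change under `s ↦ s⁻¹`, so the inverse of a generator is the same generator
with `s⁻¹` in place of `s`. -/
lemma burau_mirror {n : ℕ} (s : Rˣ) (w : BraidGroup n) :
    burau n s (BraidGroup.mirror w) = burau n s⁻¹ w := by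
  have : (burau n s).comp BraidGroup.mirror = burau n s⁻¹ := by
    refine PresentedGroup.ext fun i => ?_
    have : BraidGroup.mirror (.of i : BraidGroup n) = (BraidGroup.σ i)⁻¹ :=
      PresentedGroup.toGroup.of _
    rw [MonoidHom.comp_apply, this, map_inv, burau_σ, burauGen_inv]
    exact (burau_σ _ _).symm
  exact congrArg (fun g => g w) this

/-- The braids with this property form a subgroup, so generators suffice. For these, `Uᵀ J = J U`
and `U² = (s + s⁻¹) U` make the linear and quadratic terms in `U` cancel. -/
lemma burau_isometry {n : ℕ} (s : Rˣ) (w : BraidGroup n) :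
    (burau n s w).valᵀ * burauForm (n - 1) s * (burau n s⁻¹ w).val = burauForm (n - 1) s := by
  let H : Subgroup (BraidGroup n) :=
    { carrier := {w | (burau n s w).valᵀ * burauForm (n - 1) s * (burau n s⁻¹ w).val =
        burauForm (n - 1) s}
      one_mem' := by simp
      mul_mem' := by
        intro a b ha hb
        simp only [Set.mem_ofPred_eq, map_mul, Units.val_mul, transpose_mul] at *
        nth_rw 2 [← hb]
        nth_rw 2 [← ha]
        simp only [mul_assoc]
      inv_mem' := by
        intro a ha
        simp only [Set.mem_ofPred_eq, map_inv] at *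
        nth_rw 1 [← ha]
        rw [mul_assoc, mul_assoc, mul_assoc, Units.mul_inv, mul_one, ← mul_assoc, ← transpose_mul,
          Units.mul_inv, transpose_one, one_mul] }
  refine PresentedGroup.generated_by _ H (fun i => ?_) w
  change (burau n s (BraidGroup.σ i)).valᵀ * _ * (burau n s⁻¹ (BraidGroup.σ i)).val = _
  rw [burau_σ, burau_σ]
  simp only [burauGen, temperleyLieb_inv, transpose_sub, transpose_one, transpose_smul]
  have h : (temperleyLieb s i)ᵀ * burauForm (n - 1) s = burauForm (n - 1) s * temperleyLieb s i := by
    rw [temperleyLieb, transpose_mul, burauForm_transpose, transpose_single, mul_assoc]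
  simp only [sub_mul, mul_sub, one_mul, mul_one, Matrix.smul_mul, Matrix.mul_smul, h]
  rw [mul_assoc, temperleyLieb_mul_self]
  simp only [Matrix.mul_smul, smul_smul]
  rw [show ((s⁻¹ : Rˣ) : R) * (s * (s + (s⁻¹ : Rˣ))) = s + (s⁻¹ : Rˣ) by simp [← mul_assoc]]
  module

/-- The diagonal matrix of the signs `(-1)^i`. -/
def alternatingSign (R : Type*) [CommRing R] (N : ℕ) : (Matrix (Fin N) (Fin N) R)ˣ where
  val := diagonal fun i => (-1) ^ (i : ℕ)
  inv := diagonal fun i => (-1) ^ (i : ℕ)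
  val_inv := by simp [diagonal_mul_diagonal, ← mul_pow]
  inv_val := by simp [diagonal_mul_diagonal, ← mul_pow]

/-- Conjugation by alternating signs flips the off-diagonal entries of `J`, while `s ↦ -s` flips the
diagonal ones; the remaining overall sign is absorbed by the factor `s` of `s • U`. -/
lemma burauGen_neg {N : ℕ} (s : Rˣ) (i : Fin N) :
    burauGen (-s) i = alternatingSign R N * burauGen s i * (alternatingSign R N)⁻¹ := by
  rw [eq_mul_inv_iff_mul_eq]
  ext a b
  simp only [alternatingSign, Units.val_mul, mul_diagonal, diagonal_mul]
  simp only [burauGen, Matrix.sub_apply, Matrix.smul_apply, temperleyLieb_apply, burauForm,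
    of_apply, one_apply, smul_eq_mul]
  rcases eq_or_ne a b with rfl | hab
  · by_cases h : i = a
    · simp [h]
      ring
    · simp [h]
  · simp only [hab, if_false]
    by_cases h : i = a
    · by_cases h' : (a : ℕ) + 1 = b
      · have e : (-1 : R) ^ (b : ℕ) = -(-1) ^ (a : ℕ) := by rw [← h', pow_succ, mul_neg_one]
        simp [h, h', e, mul_comm]
      · by_cases h'' : (b : ℕ) + 1 = a
        · have e : (-1 : R) ^ (a : ℕ) = -(-1) ^ (b : ℕ) := by rw [← h'', pow_succ, mul_neg_one]
          simp [h, h'', e, mul_comm]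
        · simp [h', h'']
    · simp [h]

lemma burau_neg {n : ℕ} (s : Rˣ) (w : BraidGroup n) :
    burau n (-s) w =
      alternatingSign R (n - 1) * burau n s w * (alternatingSign R (n - 1))⁻¹ := by
  have : burau n (-s) = (MulAut.conj (alternatingSign R (n - 1))).toMonoidHom.comp (burau n s) := by
    refine PresentedGroup.ext fun i => ?_
    change burau n (-s) (BraidGroup.σ i) = MulAut.conj _ (burau n s (BraidGroup.σ i))
    rw [burau_σ, burau_σ, MulAut.conj_apply, burauGen_neg]
  exact congrArg (fun g => g w) this

lemma det_burauGen {N : ℕ} (s : Rˣ) (i : Fin N) : (burauGen s i).val.det = -(s : R) ^ 2 := by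
  have h : (burauGen s i).val =
      1 - replicateCol Unit (Pi.single i (s : R)) * replicateRow Unit (burauForm N s i) := by
    ext a b
    simp only [burauGen, Matrix.sub_apply, Matrix.smul_apply, temperleyLieb_apply, mul_apply,
      replicateCol_apply, replicateRow_apply, Finset.univ_unique, Finset.sum_singleton,
      Pi.single_apply, smul_eq_mul]
    by_cases h : a = i
    · simp [h]
    · simp [h, Ne.symm h]
  rw [h, sub_eq_add_neg, ← Matrix.neg_mul, det_one_add_mul_comm, det_unique]
  simp only [Matrix.add_apply, one_apply_eq, mul_apply, replicateRow_apply, Matrix.neg_apply,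
    replicateCol_apply, Pi.single_apply, mul_neg, mul_ite, mul_zero, Finset.sum_neg_distrib,
    Finset.sum_ite_eq', Finset.mem_univ, if_true, burauForm, of_apply]
  linear_combination -s.inv_mul

/-- What matters later is that this unit is a square up to sign. -/
lemma exists_det_burau {n : ℕ} (s : Rˣ) (w : BraidGroup n) :
    ∃ e : ℤ, (burau n s w).val.det = ((-s ^ 2 : Rˣ) ^ e : Rˣ) := by
  let H := (Subgroup.zpowers (-s ^ 2 : Rˣ)).comap
    ((Units.map (detMonoidHom : Matrix (Fin (n - 1)) (Fin (n - 1)) R →* R)).comp (burau n s))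
  have : w ∈ H := by
    refine PresentedGroup.generated_by _ H (fun i => ?_) w
    refine ⟨1, ?_⟩
    ext1
    change _ = (burau n s (BraidGroup.σ i)).val.det
    simp [burau_σ, det_burauGen]
  obtain ⟨e, he⟩ := this
  exact ⟨e, (congrArg Units.val he).symm⟩

end Burau

/-! ### Quantum integers and the determinant of the Burau form. -/

section QuantumInteger

open Matrix

variable {R S : Type*} [CommRing R] [CommRing S]

/-- The balanced quantum integer `[n] = s^(n-1) + s^(n-3) + ⋯ + s^(1-n)`. -/
def quantumInt (s : Rˣ) (n : ℕ) : R :=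
  ∑ i ∈ Finset.range n, (s : R) ^ i * ((s⁻¹ : Rˣ) : R) ^ (n - 1 - i)

lemma quantumInt_zero (s : Rˣ) : quantumInt s 0 = 0 := rfl

lemma quantumInt_one (s : Rˣ) : quantumInt s 1 = 1 := by simp [quantumInt]

lemma quantumInt_succ (s : Rˣ) (n : ℕ) :
    quantumInt s (n + 1) = s ^ n + ((s⁻¹ : Rˣ) : R) * quantumInt s n := by
  simp only [quantumInt, Finset.sum_range_succ, Finset.mul_sum]
  rw [add_comm]
  congr 1
  · simp
  · refine Finset.sum_congr rfl fun i hi => ?_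
    rw [Finset.mem_range] at hi
    rw [show n + 1 - 1 - i = n - 1 - i + 1 by omega]
    ring

lemma quantumInt_succ' (s : Rˣ) (n : ℕ) :
    quantumInt s (n + 1) = ((s⁻¹ : Rˣ) : R) ^ n + s * quantumInt s n := by
  simp only [quantumInt, Finset.sum_range_succ', Finset.mul_sum]
  rw [add_comm]
  congr 1
  · simp
  · refine Finset.sum_congr rfl fun i hi => ?_
    rw [show n + 1 - 1 - (i + 1) = n - 1 - i by omega]
    ring

lemma quantumInt_add_two (s : Rˣ) (n : ℕ) :
    quantumInt s (n + 2) = (s + (s⁻¹ : Rˣ)) * quantumInt s (n + 1) - quantumInt s n := by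
  linear_combination quantumInt_succ s (n + 1) - (s : R) * quantumInt_succ s n
    - quantumInt s n * s.mul_inv

lemma quantumInt_map (f : R →+* S) (s : Rˣ) (n : ℕ) :
    f (quantumInt s n) = quantumInt (Units.map (f : R →* S) s) n := by
  simp [quantumInt, ← map_inv]

lemma pow_mul_quantumInt (s : Rˣ) (n : ℕ) :
    (s : R) ^ (n - 1) * quantumInt s n = ∑ i ∈ Finset.range n, ((s : R) ^ 2) ^ i := by
  rw [quantumInt, Finset.mul_sum]
  refine Finset.sum_congr rfl fun i hi => ?_
  rw [Finset.mem_range] at hi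
  obtain ⟨k, hk⟩ : ∃ k, n - 1 = i + k := ⟨n - 1 - i, by omega⟩
  rw [hk, Nat.add_sub_cancel_left]
  have h : ((s : R) * (s⁻¹ : Rˣ)) ^ k = 1 := by simp
  rw [mul_pow] at h
  linear_combination (s : R) ^ (2 * i) * h

lemma quantumInt_odd (s : Rˣ) (l : ℕ) :
    quantumInt s (2 * l + 1) = quantumInt s (l + 1) ^ 2 - quantumInt s l ^ 2 := by
  -- The three-term recursion mixes parities, so a formula for the even indices has to be carried
  -- along.
  have key (l : ℕ) : quantumInt s (2 * l + 1) = quantumInt s (l + 1) ^ 2 - quantumInt s l ^ 2 ∧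
      quantumInt s (2 * l + 2) = quantumInt s (l + 1) *
        ((s + (s⁻¹ : Rˣ)) * quantumInt s (l + 1) - 2 * quantumInt s l) := by
    induction l with
    | zero => simp [quantumInt_one, quantumInt_zero, quantumInt_add_two s 0]
    | succ l ih =>
      obtain ⟨h1, h2⟩ := ih
      have e1 := quantumInt_add_two s l
      have h3 : quantumInt s (2 * (l + 1) + 1) = quantumInt s (l + 1 + 1) ^ 2
          - quantumInt s (l + 1) ^ 2 := by
        rw [show 2 * (l + 1) + 1 = 2 * l + 1 + 2 by ring, quantumInt_add_two,
          show 2 * l + 1 + 1 = 2 * l + 2 by ring, h2, h1, e1]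
        ring
      refine ⟨h3, ?_⟩
      rw [show 2 * (l + 1) + 2 = 2 * l + 2 + 2 by ring, quantumInt_add_two,
        show 2 * l + 2 + 1 = 2 * (l + 1) + 1 by ring, h3, h2, show l + 1 + 1 = l + 2 by ring, e1]
      ring
  exact (key l).1

/-- Laplace expansion along the first row of a tridiagonal matrix; this is the recursion of the
quantum integers. -/
lemma det_burauForm_succ_succ (N : ℕ) (s : Rˣ) :
    (burauForm (N + 2) s).det =
      (s + (s⁻¹ : Rˣ)) * (burauForm (N + 1) s).det - (burauForm N s).det := by
  have hsub (N : ℕ) : (burauForm (N + 1) s).submatrix Fin.succ Fin.succ = burauForm N s := by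
    ext i j
    simp [burauForm]
  rw [det_succ_row_zero, Fin.sum_univ_succ, Fin.sum_univ_succ, Finset.sum_eq_zero]
  · have h2 : ((burauForm (N + 2) s).submatrix Fin.succ (Fin.succAbove (Fin.succ 0))).det =
        -(burauForm N s).det := by
      rw [det_succ_column_zero, Fin.sum_univ_succ, Finset.sum_eq_zero]
      · have : ((burauForm (N + 2) s).submatrix Fin.succ (Fin.succAbove (Fin.succ 0))).submatrix
            (Fin.succAbove 0) Fin.succ = burauForm N s := by
          ext i j
          simp [burauForm]
        rw [this]
        simp [burauForm]
      · intro i _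
        simp [burauForm]
    have h00 : burauForm (N + 2) s 0 0 = s + (s⁻¹ : Rˣ) := by simp [burauForm]
    have h01 : burauForm (N + 2) s 0 (Fin.succ 0) = -1 := by simp [burauForm]
    rw [h2, Fin.succAbove_zero, hsub, h00, h01]
    simp
    ring
  · intro i _
    simp [burauForm, (Fin.succ_ne_zero _).symm]

lemma det_burauForm (N : ℕ) (s : Rˣ) : (burauForm N s).det = quantumInt s (N + 1) := by
  have key (N : ℕ) : (burauForm N s).det = quantumInt s (N + 1) ∧
      (burauForm (N + 1) s).det = quantumInt s (N + 2) := by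
    induction N with
    | zero =>
      rw [quantumInt_add_two, quantumInt_one, quantumInt_zero]
      simp [burauForm]
    | succ N ih =>
      refine ⟨ih.2, ?_⟩
      rw [det_burauForm_succ_succ, ih.1, ih.2, quantumInt_add_two s (N + 1)]
  exact (key N).1

end QuantumInteger

/-! ### Skew-symmetric determinants. -/

section SkewSymmetric

open Matrix

/-- The determinant of a skew-symmetric matrix of even size is a square. -/
lemma exists_det_eq_sq_of_transpose_eq_neg {K : Type*} [Field K] (h2 : (2 : K) ≠ 0) (n : ℕ) :
    ∀ {ι : Type} [Fintype ι] [DecidableEq ι] (S : Matrix ι ι K), Fintype.card ι = 2 * n →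
      Sᵀ = -S → ∃ x, S.det = x ^ 2 := by
  induction n with
  | zero =>
    intro ι _ _ S hι hS
    have : IsEmpty ι := Fintype.card_eq_zero_iff.1 (by simpa using hι)
    exact ⟨1, by simp⟩
  | succ n ih =>
    intro ι _ _ S hι hS
    have hS' (a b : ι) : S a b = -S b a := by
      rw [← neg_apply, ← hS, transpose_apply]
    have hd (a : ι) : S a a = 0 := by
      have := hS' a a
      have : 2 * S a a = 0 := by linear_combination this
      exact (mul_eq_zero.1 this).resolve_left h2
    by_cases h0 : S = 0
    · have : Nonempty ι := Fintype.card_pos_iff.1 (by omega)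
      exact ⟨0, by simp [h0]⟩
    obtain ⟨i, j, hij⟩ : ∃ i j, S i j ≠ 0 := by
      by_contra! h
      exact h0 (Matrix.ext h)
    have hne : i ≠ j := by
      rintro rfl
      exact hij (hd i)
    -- The rows and columns `i`, `j` form an invertible skew block of determinant `S i j ^ 2`.
    let p : ι → Prop := fun x => x = i ∨ x = j
    let f : Fin 2 → {x // p x} := ![⟨i, .inl rfl⟩, ⟨j, .inr rfl⟩]
    have hf : Function.Bijective f := by
      constructor
      · intro a b hab
        have h := congrArg Subtype.val hab
        fin_cases a <;> fin_cases b <;>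
          first | rfl | exact absurd h hne | exact absurd h hne.symm
      · rintro ⟨x, rfl | rfl⟩
        · exact ⟨0, rfl⟩
        · exact ⟨1, rfl⟩
    have hA : (toBlock S p p).det = S i j ^ 2 := by
      rw [← det_submatrix_equiv_self (Equiv.ofBijective f hf), det_fin_two]
      simp only [submatrix_apply, Equiv.ofBijective_apply, toBlock_apply, f, cons_val_zero,
        cons_val_one, hd, hS' j i]
      ring
    have hcard : Fintype.card {x // ¬ p x} = 2 * n := by
      rw [Fintype.card_subtype_compl, hι, ← Fintype.card_of_bijective hf, Fintype.card_fin]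
      omega
    have hAu : IsUnit (toBlock S p p).det := by
      rw [hA]
      exact (pow_ne_zero 2 hij).isUnit
    let : Invertible (toBlock S p p) := invertibleOfIsUnitDet _ hAu
    have hT (q r : ι → Prop) : (toBlock S q r)ᵀ = -toBlock S r q := by
      ext a b
      simp [hS' a b]
    -- The Schur complement of the chosen block is again skew-symmetric, of size smaller by 2.
    obtain ⟨x, hx⟩ := ih (toBlock S (fun i => ¬ p i) (fun i => ¬ p i) -
      toBlock S (fun i => ¬ p i) p * ⅟(toBlock S p p) * toBlock S p (fun i => ¬ p i)) hcard (by
        rw [transpose_sub, transpose_mul, transpose_mul, hT, hT, hT, invOf_eq_nonsing_inv,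
          transpose_nonsing_inv, hT, neg_sub]
        have : (-toBlock S p p)⁻¹ = -(toBlock S p p)⁻¹ := by
          refine inv_eq_left_inv ?_
          rw [neg_mul_neg, nonsing_inv_mul _ hAu]
        rw [this]
        simp only [Matrix.neg_mul, Matrix.mul_neg, neg_neg, Matrix.mul_assoc, sub_neg_eq_add]
        exact neg_add_eq_sub _ _)
    refine ⟨S i j * x, ?_⟩
    rw [det_toBlock S p, det_fromBlocks₁₁, hA, hx, mul_pow]

end SkewSymmetric

/-! ### Laurent polynomials in `s` invariant under `s ↦ s⁻¹` and `s ↦ -s`. -/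

section LaurentInvariants

lemma LaurentPolynomial.coeff_C_mul {R : Type*} [CommSemiring R] (a : R) (x : R[T;T⁻¹]) (j : ℤ) :
    (LaurentPolynomial.C a * x).coeff j = a * x.coeff j := by
  rw [← LaurentPolynomial.smul_eq_C_mul]
  rfl

/-- The variable `s = T 1` as a unit. -/
noncomputable def laurentVar : ℤ[T;T⁻¹]ˣ where
  val := LaurentPolynomial.T 1
  inv := LaurentPolynomial.T (-1)
  val_inv := by rw [← LaurentPolynomial.T_add, add_neg_cancel, LaurentPolynomial.T_zero]
  inv_val := by rw [← LaurentPolynomial.T_add, neg_add_cancel, LaurentPolynomial.T_zero]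

lemma laurentVar_val : (laurentVar : ℤ[T;T⁻¹]) = LaurentPolynomial.T 1 := rfl

lemma laurentVar_inv_val : ((laurentVar⁻¹ : ℤ[T;T⁻¹]ˣ) : ℤ[T;T⁻¹]) = LaurentPolynomial.T (-1) := rfl

lemma laurentVar_zpow (k : ℤ) :
    ((laurentVar ^ k : ℤ[T;T⁻¹]ˣ) : ℤ[T;T⁻¹]) = LaurentPolynomial.T k := by
  have : laurentVar = (LaurentPolynomial.isUnit_T (R := ℤ) 1).unit := Units.ext rfl
  rw [this, LaurentPolynomial.coe_unit_T_zpow, one_mul]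

/-- The involution `s ↦ s⁻¹` as a ring homomorphism. -/
noncomputable def laurentBar : ℤ[T;T⁻¹] →+* ℤ[T;T⁻¹] :=
  (LaurentPolynomial.invert (R := ℤ)).toAlgHom.toRingHom

/-- The involution `s ↦ -s`. -/
noncomputable def laurentNeg : ℤ[T;T⁻¹] →+* ℤ[T;T⁻¹] :=
  LaurentPolynomial.eval₂ LaurentPolynomial.C (-laurentVar)

lemma laurentBar_apply (x : ℤ[T;T⁻¹]) : laurentBar x = LaurentPolynomial.invert x := rfl

lemma map_laurentBar_laurentVar :
    Units.map (laurentBar : ℤ[T;T⁻¹] →* ℤ[T;T⁻¹]) laurentVar = laurentVar⁻¹ :=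
  Units.ext (LaurentPolynomial.invert_T 1)

lemma map_laurentNeg_laurentVar :
    Units.map (laurentNeg : ℤ[T;T⁻¹] →* ℤ[T;T⁻¹]) laurentVar = -laurentVar := by
  ext1
  change laurentNeg (LaurentPolynomial.T 1) = _
  rw [laurentNeg, LaurentPolynomial.eval₂_T, zpow_one]

lemma laurentNeg_T (k : ℤ) :
    laurentNeg (LaurentPolynomial.T k) = ((-1 : ℤˣ) ^ k : ℤˣ) • LaurentPolynomial.T k := by
  have h : ((-laurentVar) ^ k : ℤ[T;T⁻¹]ˣ) = (-1) ^ k * laurentVar ^ k := by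
    rw [← mul_zpow, neg_one_mul]
  rw [laurentNeg, LaurentPolynomial.eval₂_T, h, Units.val_mul, laurentVar_zpow]
  rcases Int.even_or_odd k with hk | hk
  · simp [hk.neg_one_zpow]
  · simp [hk.neg_one_zpow]

lemma coeff_laurentNeg (x : ℤ[T;T⁻¹]) (k : ℤ) :
    (laurentNeg x).coeff k = ((-1 : ℤˣ) ^ k : ℤˣ) * x.coeff k := by
  induction x using LaurentPolynomial.induction_on' with
  | add p q hp hq => simp [hp, hq, mul_add]
  | C_mul_T n a =>
    have : laurentNeg (LaurentPolynomial.C a) = LaurentPolynomial.C a := by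
      rw [laurentNeg, LaurentPolynomial.eval₂_C]
    have hT : (laurentNeg (LaurentPolynomial.T n)).coeff k =
        ((-1 : ℤˣ) ^ n : ℤˣ) * (LaurentPolynomial.T n : ℤ[T;T⁻¹]).coeff k := by
      rw [laurentNeg_T, Units.smul_def, LaurentPolynomial.smul_eq_C_mul,
        LaurentPolynomial.coeff_C_mul]
    rw [map_mul, this, LaurentPolynomial.coeff_C_mul, LaurentPolynomial.coeff_C_mul, hT,
      LaurentPolynomial.T_apply]
    by_cases h : n = k
    · rw [h]
      ring
    · simp [h]

/-- The substitution `X = z² = (s - s⁻¹)²`. -/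
noncomputable def substConwaySq : ℤ[X] →+* ℤ[T;T⁻¹] :=
  substConway.comp (Polynomial.expand ℤ 2).toRingHom

lemma substConwaySq_apply (P : ℤ[X]) :
    substConwaySq P = substConway (Polynomial.expand ℤ 2 P) := rfl

lemma substConwaySq_injective : Function.Injective substConwaySq := by
  refine (injective_iff_map_eq_zero _).2 fun P hP => ?_
  exact (Polynomial.expand_eq_zero two_pos).1 (substConway_injective hP)

lemma substConwaySq_X : substConwaySq Polynomial.X =
    (LaurentPolynomial.T 1 - LaurentPolynomial.T (-1)) ^ 2 := by
  simp [substConwaySq_apply, substConway]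

lemma substConwaySq_C (a : ℤ) : substConwaySq (Polynomial.C a) = LaurentPolynomial.C a := by
  simp

/-- Chebyshev recursion, starting from `s² + s⁻² = z² + 2`. These elements span the invariants
together with the constants. -/
lemma T_add_T_neg_mem_range (k : ℕ) :
    (LaurentPolynomial.T (2 * k) + LaurentPolynomial.T (-(2 * k)) : ℤ[T;T⁻¹]) ∈
      substConwaySq.range := by
  have h1 : (LaurentPolynomial.T 2 + LaurentPolynomial.T (-2) : ℤ[T;T⁻¹]) ∈
      substConwaySq.range := by
    refine ⟨Polynomial.X + 2, ?_⟩
    rw [map_add, substConwaySq_X, map_ofNat, sub_sq, LaurentPolynomial.T_pow,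
      LaurentPolynomial.T_pow, mul_assoc, ← LaurentPolynomial.T_add]
    simp
    ring
  have key : ∀ k : ℕ, (LaurentPolynomial.T (2 * k) + LaurentPolynomial.T (-(2 * k)) : ℤ[T;T⁻¹]) ∈
      substConwaySq.range ∧ (LaurentPolynomial.T (2 * (k + 1 : ℕ)) +
        LaurentPolynomial.T (-(2 * (k + 1 : ℕ))) : ℤ[T;T⁻¹]) ∈ substConwaySq.range := by
    intro k
    induction k with
    | zero => exact ⟨⟨2, by simpa [one_add_one_eq_two] using map_ofNat substConwaySq 2⟩, by simpa using h1⟩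
    | succ k ih =>
      refine ⟨ih.2, ?_⟩
      convert sub_mem (mul_mem h1 ih.2) ih.1 using 1
      simp only [add_mul, mul_add, ← LaurentPolynomial.T_add]
      push_cast
      ring_nf
  exact (key k).1

/-- The Laurent polynomials in `s` that are invariant under `s ↦ s⁻¹` and `s ↦ -s` are the
polynomials in `z² = (s - s⁻¹)²`. -/
lemma mem_range_substConwaySq {x : ℤ[T;T⁻¹]} (hb : laurentBar x = x) (hn : laurentNeg x = x) :
    x ∈ substConwaySq.range := by
  -- Induction on a bound `2k` for the degree: subtract the multiple of `s^(2k) + s^(-2k)` that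
  -- cancels the extreme coefficients.
  have key : ∀ (k : ℕ) (x : ℤ[T;T⁻¹]), (∀ j : ℤ, x.coeff (-j) = x.coeff j) →
      (∀ j : ℤ, Odd j → x.coeff j = 0) → (∀ j : ℤ, 2 * k < j → x.coeff j = 0) →
      x ∈ substConwaySq.range := by
    intro k
    induction k with
    | zero =>
      intro x h1 h2 h3
      refine ⟨Polynomial.C (x.coeff 0), ?_⟩
      rw [substConwaySq_C]
      ext j
      rw [LaurentPolynomial.C_apply]
      rcases lt_trichotomy j 0 with h | h | h
      · rw [if_neg h.ne, ← h1, h3 _ (by simpa using h)]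
      · simp [h]
      · rw [if_neg h.ne', h3 _ (by simpa using h)]
    | succ k ih =>
      intro x h1 h2 h3
      have hmem := T_add_T_neg_mem_range (k + 1)
      set e : ℤ[T;T⁻¹] := LaurentPolynomial.T (2 * (k + 1 : ℕ)) +
        LaurentPolynomial.T (-(2 * (k + 1 : ℕ))) with he
      have hc (j : ℤ) : e.coeff j = (if 2 * (k + 1 : ℤ) = j then 1 else 0) +
          if -(2 * (k + 1 : ℤ)) = j then 1 else 0 := by
        simp [he]
      set a := x.coeff (2 * (k + 1))
      have hx (j : ℤ) : (x - LaurentPolynomial.C a * e).coeff j = x.coeff j - a * e.coeff j := by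
        rw [← LaurentPolynomial.coeff_C_mul]
        rfl
      have : x - LaurentPolynomial.C a * e ∈ substConwaySq.range := by
        refine ih _ (fun j => ?_) (fun j hj => ?_) fun j hj => ?_
        · rw [hx, hx, h1, hc, hc, add_comm]
          simp only [neg_neg, eq_comm (a := 2 * (k + 1 : ℤ)), eq_comm (a := -(2 * (k + 1 : ℤ))),
            neg_eq_iff_eq_neg]
        · rw [hx, h2 j hj, hc, if_neg, if_neg]
          · simp
          · rintro rfl
            exact (Int.not_odd_iff_even.2 (even_two_mul _).neg) hj
          · rintro rfl
            exact (Int.not_odd_iff_even.2 (even_two_mul _)) hj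
        -- Between the two degree bounds only `2k + 2` and `2k + 1` occur: the first coefficient has
        -- been cancelled, the second vanishes by parity.
        · have hj' : ¬ -(2 * (k + 1 : ℤ)) = j := by omega
          rw [hx, hc, if_neg hj']
          rcases eq_or_ne (2 * (k + 1 : ℤ)) j with rfl | h
          · simp [a]
          · rw [if_neg h]
            rcases lt_or_ge (2 * ((k + 1 : ℕ) : ℤ)) j with h' | h'
            · simp [h3 j h']
            · have : j = 2 * k + 1 := by push_cast at h'; omega
              simp [h2 j ⟨k, this⟩]
      have h := add_mem this (mul_mem (⟨_, substConwaySq_C a⟩ : LaurentPolynomial.C a ∈ substConwaySq.range) hmem)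
      rwa [sub_add_cancel] at h
  obtain ⟨k, hk⟩ : ∃ k : ℕ, ∀ j ∈ x.coeff.support, j ≤ k := by
    obtain ⟨B, hB⟩ := x.coeff.support.bddAbove
    exact ⟨B.toNat, fun j hj => (hB hj).trans (Int.self_le_toNat B)⟩
  refine key k x (fun j => ?_) (fun j hj => ?_) fun j hj => ?_
  · conv_rhs => rw [← hb]
    rw [laurentBar_apply, LaurentPolynomial.invert_apply]
  · have := coeff_laurentNeg x j
    rw [hn, hj.neg_one_zpow] at this
    simp at this
    omega
  · by_contra h
    have := hk j (Finsupp.mem_support_iff.2 h)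
    omega

lemma quantumInt_inv {R : Type*} [CommRing R] (s : Rˣ) (n : ℕ) :
    quantumInt s⁻¹ n = quantumInt s n := by
  induction n with
  | zero => rfl
  | succ n ih => rw [quantumInt_succ, ih, quantumInt_succ', inv_inv]

lemma quantumInt_neg {R : Type*} [CommRing R] (s : Rˣ) (l : ℕ) :
    quantumInt (-s) (2 * l + 1) = quantumInt s (2 * l + 1) := by
  simp only [quantumInt]
  refine Finset.sum_congr rfl fun i hi => ?_
  rw [inv_neg, Units.val_neg, Units.val_neg, neg_pow, neg_pow ((s⁻¹ : Rˣ) : R),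
    mul_mul_mul_comm, ← pow_add, Finset.mem_range] at *
  rw [show i + (2 * l + 1 - 1 - i) = 2 * l by omega, pow_mul]
  simp

/-- An even quantum integer is not a polynomial in `z²`, but its cofactor `[n]` at `s²` is, and `(s
+ s⁻¹)² = z² + 4`. -/
lemma quantumInt_two_mul {R : Type*} [CommRing R] (s : Rˣ) (n : ℕ) :
    quantumInt s (2 * n) = (s + (s⁻¹ : Rˣ)) * quantumInt (s ^ 2) n := by
  have key (n : ℕ) : quantumInt s (2 * n) = (s + (s⁻¹ : Rˣ)) * quantumInt (s ^ 2) n ∧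
      quantumInt s (2 * (n + 1)) = (s + (s⁻¹ : Rˣ)) * quantumInt (s ^ 2) (n + 1) := by
    induction n with
    | zero => simp [quantumInt_zero, quantumInt_one, quantumInt_add_two s 0]
    | succ n ih =>
      refine ⟨ih.2, ?_⟩
      have h1 := quantumInt_add_two s (2 * n + 2)
      have h2 := quantumInt_add_two s (2 * n + 1)
      have h3 := quantumInt_add_two s (2 * n)
      have h4 := quantumInt_add_two (s ^ 2) n
      rw [← inv_pow, Units.val_pow_eq_pow_val, Units.val_pow_eq_pow_val] at h4
      rw [show 2 * (n + 1 + 1) = 2 * n + 2 + 2 by ring, h4, mul_sub, ← ih.1, mul_left_comm,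
        ← ih.2, h1, h2]
      rw [show 2 * (n + 1) = 2 * n + 2 by ring]
      linear_combination h3 + 2 * quantumInt s (2 * n + 2) * s.mul_inv
  exact (key n).1

lemma laurentBar_quantumInt (n : ℕ) :
    laurentBar (quantumInt laurentVar n) = quantumInt laurentVar n := by
  rw [quantumInt_map, map_laurentBar_laurentVar, quantumInt_inv]

lemma quantumInt_laurentVar_mem_range (l : ℕ) :
    quantumInt laurentVar (2 * l + 1) ∈ substConwaySq.range :=
  mem_range_substConwaySq (laurentBar_quantumInt _) <| by
    rw [quantumInt_map, map_laurentNeg_laurentVar, quantumInt_neg]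

lemma quantumInt_laurentVar_sq_mem_range (n : ℕ) :
    quantumInt (laurentVar ^ 2) n ∈ substConwaySq.range :=
  mem_range_substConwaySq
    (by rw [quantumInt_map, map_pow, map_laurentBar_laurentVar, inv_pow, quantumInt_inv])
    (by rw [quantumInt_map, map_pow, map_laurentNeg_laurentVar, neg_sq])

lemma quantumInt_one_left {R : Type*} [CommRing R] (n : ℕ) : quantumInt (1 : Rˣ) n = n := by
  simp [quantumInt]

/-- Evaluation of a Laurent polynomial at `1`. -/
noncomputable def laurentEvalOne : ℤ[T;T⁻¹] →+* ℤ :=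
  LaurentPolynomial.eval₂ (Int.castRingHom ℤ) 1

lemma map_laurentEvalOne_laurentVar :
    Units.map (laurentEvalOne : ℤ[T;T⁻¹] →* ℤ) laurentVar = 1 := by
  ext1
  change laurentEvalOne (LaurentPolynomial.T 1) = _
  rw [laurentEvalOne, LaurentPolynomial.eval₂_T, one_zpow]

lemma quantumInt_laurentVar_ne_zero {n : ℕ} (hn : n ≠ 0) : quantumInt laurentVar n ≠ 0 := by
  intro h
  have := congrArg laurentEvalOne h
  rw [quantumInt_map, map_laurentEvalOne_laurentVar, quantumInt_one_left, map_zero] at this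
  exact hn (by exact_mod_cast this)

/-- For odd `n`, the quantum integer `[n]` is `±(a² - (z² + 4) b²)` for polynomials `a`, `b` in
`z²`. -/
lemma exists_quantumInt_eq (l : ℕ) : ∃ (a b : ℤ[X]) (ε : ℤˣ),
    quantumInt laurentVar (2 * l + 1) = substConwaySq
      (Polynomial.C (ε : ℤ) * (a ^ 2 - (Polynomial.X + 4) * b ^ 2)) := by
  have h4 : substConwaySq (Polynomial.X + 4) =
      ((laurentVar : ℤ[T;T⁻¹]) + (laurentVar⁻¹ : ℤ[T;T⁻¹]ˣ)) ^ 2 := by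
    rw [map_add, substConwaySq_X, map_ofNat, ← laurentVar_val, ← laurentVar_inv_val]
    linear_combination (-4 : ℤ[T;T⁻¹]) * laurentVar.mul_inv
  rw [quantumInt_odd]
  -- Exactly one of `l`, `l + 1` is even. It contributes the term with `z² + 4`, and its position in
  -- `[l+1]² - [l]²` decides the sign.
  rcases Nat.even_or_odd' l with ⟨j, rfl | rfl⟩
  · obtain ⟨a, ha⟩ := quantumInt_laurentVar_mem_range j
    obtain ⟨b, hb⟩ := quantumInt_laurentVar_sq_mem_range j
    refine ⟨a, b, 1, ?_⟩
    rw [quantumInt_two_mul, map_mul, map_sub, map_mul, h4, map_pow, map_pow, ha, hb]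
    simp
    ring
  · obtain ⟨a, ha⟩ := quantumInt_laurentVar_mem_range j
    obtain ⟨b, hb⟩ := quantumInt_laurentVar_sq_mem_range (j + 1)
    refine ⟨a, b, -1, ?_⟩
    rw [show 2 * j + 1 + 1 = 2 * (j + 1) by ring, quantumInt_two_mul, map_mul, map_sub, map_mul, h4,
      map_pow, map_pow, ha, hb]
    simp
    ring

lemma laurentEvalOne_substConwaySq (P : ℤ[X]) : laurentEvalOne (substConwaySq P) = P.eval 0 := by
  rw [substConwaySq_apply, laurentEvalOne, substConway_eval_one]
  simp

end LaurentInvariants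

/-! ### Isometries and palindromic characteristic polynomials. -/

section Palindromic

open Matrix Polynomial

variable {R : Type*} [CommRing R]

/-- Modulo `X² + 1` the left side is 0 for odd `k`. For `k = 2m` it is 2, and `X ^ k` is the sign
`(-1)^m`. -/
lemma exists_one_add_X_pow_eq (k : ℕ) :
    ∃ (b : R) (Q : R[X]), 1 + X ^ (2 * k) = C b * X ^ k + (X ^ 2 + 1) * Q := by
  rcases Nat.even_or_odd' k with ⟨m, rfl | rfl⟩
  · obtain ⟨Q, hQ⟩ := sub_dvd_pow_sub_pow (X ^ 2 : R[X]) (-1) m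
    have h1 : ((-1 : R[X]) ^ m) ^ 2 = 1 := by rw [← pow_mul, mul_comm, pow_mul]; simp
    refine ⟨2 * (-1) ^ m, Q * (X ^ (2 * m) - (-1) ^ m), ?_⟩
    rw [sub_neg_eq_add, ← pow_mul] at hQ
    simp only [map_mul, map_pow, map_neg, map_one, map_ofNat]
    linear_combination (X ^ (2 * m) - (-1) ^ m) * hQ - h1
  · obtain ⟨Q, hQ⟩ := Odd.add_dvd_pow_add_pow (X ^ 2 : R[X]) 1 (n := 2 * m + 1) ⟨m, rfl⟩
    refine ⟨0, Q, ?_⟩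
    rw [← hQ]
    simp only [map_zero]
    ring

/-- A polynomial of degree at most `2h` with palindromic coefficients is congruent to a multiple of
`X ^ h` modulo `X ^ 2 + 1`, and its values at `1` and `-1` are congruent modulo `4` up to sign. -/
lemma exists_eq_of_palindromic (h : ℕ) : ∀ P : R[X], P.natDegree ≤ 2 * h →
    (∀ i j, i + j = 2 * h → P.coeff i = P.coeff j) →
    (∃ (b : R) (Q : R[X]), P = C b * X ^ h + (X ^ 2 + 1) * Q) ∧
      ∃ r : R, P.eval 1 = (-1) ^ h * P.eval (-1) + 4 * r := by
  induction h with
  | zero =>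
    intro P hP _
    rw [eq_C_of_natDegree_le_zero (p := P) (by simpa using hP)]
    exact ⟨⟨P.coeff 0, 0, by simp⟩, 0, by simp⟩
  | succ h ih =>
    intro P hP hpal
    -- Removing the two equal end terms leaves `X` times a polynomial that is palindromic about `h`.
    set a := P.coeff 0 with ha
    set P' := divX (P - C a * (1 + X ^ (2 * (h + 1)))) with hP'
    have hc (i : ℕ) : P'.coeff i = P.coeff (i + 1) - if i + 1 = 2 * (h + 1) then a else 0 := by
      rw [hP', coeff_divX, coeff_sub, coeff_C_mul, coeff_add, coeff_one, coeff_X_pow]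
      simp
    have htop : P.coeff (2 * (h + 1)) = a := hpal _ _ (add_zero _)
    have hdeg : P'.natDegree ≤ 2 * h := by
      rw [natDegree_le_iff_coeff_eq_zero]
      intro i hi
      rw [hc]
      split_ifs with hi'
      · rw [hi', htop, sub_self]
      · rw [coeff_eq_zero_of_natDegree_lt (by omega), sub_zero]
    have hPP : P = C a * (1 + X ^ (2 * (h + 1))) + X * P' := by
      have h0 : (P - C a * (1 + X ^ (2 * (h + 1)))).coeff 0 = 0 := by
        rw [coeff_sub, coeff_C_mul, coeff_add, coeff_one, coeff_X_pow]
        simp [← ha]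
      have := X_mul_divX_add (P - C a * (1 + X ^ (2 * (h + 1))))
      rw [h0, map_zero, add_zero, ← hP'] at this
      rw [this]
      ring
    obtain ⟨⟨b, Q, hbQ⟩, r, hr⟩ := ih P' hdeg fun i j hij => by
      rw [hc, hc, if_neg (by omega), if_neg (by omega), hpal (i + 1) (j + 1) (by omega)]
    obtain ⟨b', Q', hbQ'⟩ := exists_one_add_X_pow_eq (R := R) (h + 1)
    constructor
    · refine ⟨a * b' + b, C a * Q' + X * Q, ?_⟩
      conv_lhs => rw [hPP, hbQ', hbQ]
      simp only [map_add, map_mul]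
      ring
    -- The end terms contribute `2a` at both points, and the difference `1 - (-1)^(h+1)` supplies
    -- the second factor 2.
    · have he : ∃ c : R, 1 - (-1) ^ (h + 1) = 2 * c := by
        rcases neg_one_pow_eq_or R (h + 1) with e | e
        · exact ⟨0, by rw [e]; ring⟩
        · exact ⟨1, by rw [e]; ring⟩
      obtain ⟨c, hc⟩ := he
      have hm : ((-1 : R) ^ (h + 1)) ^ 2 = 1 := by rw [← pow_mul, mul_comm, pow_mul]; simp
      refine ⟨a * c + r, ?_⟩
      rw [hPP]
      simp only [eval_add, eval_mul, eval_C, eval_one, eval_pow, eval_X, one_pow, hr]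
      rw [pow_mul, neg_one_sq, one_pow]
      rw [pow_succ] at hc ⊢
      linear_combination 2 * a * hc

variable {ι : Type*} [Fintype ι] [DecidableEq ι]

/-- Take determinants in `Mᵀ Φ (X - M) = -(1 - X M)ᵀ Φ` and cancel `det Φ`; the size is even, so the
sign disappears. -/
lemma charpoly_eq_charpolyRev_of_isometry [IsDomain R] {h : ℕ} (hι : Fintype.card ι = 2 * h)
    {M Φ : Matrix ι ι R} (hM : Mᵀ * Φ * M = Φ) (hΦ : Φ.det ≠ 0) (hdet : M.det = 1) :
    M.charpoly = M.charpolyRev := by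
  have h1 : (M.map C)ᵀ * Φ.map C * charmatrix M =
      -((1 - (X : R[X]) • M.map C)ᵀ * Φ.map C) := by
    have h2 : (M.map C)ᵀ * Φ.map C * M.map C = Φ.map C := by
      rw [← transpose_map, ← Matrix.map_mul, ← Matrix.map_mul, hM]
    have h3 : charmatrix M = (X : R[X]) • 1 - M.map C := by
      rw [charmatrix, smul_one_eq_diagonal]
      rfl
    rw [h3, mul_sub, h2, transpose_sub, transpose_smul, transpose_one, sub_mul]
    simp
  have h2 := congrArg det h1
  have hC (A : Matrix ι ι R) : (A.map C).det = C A.det := (RingHom.map_det C A).symm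
  rw [det_neg, hι, pow_mul, neg_one_sq, one_pow, one_mul, det_mul, det_mul, det_mul, det_transpose,
    det_transpose, hC, hC, hdet, map_one, one_mul, mul_comm] at h2
  exact mul_right_cancel₀ ((map_ne_zero_iff C C_injective).2 hΦ) h2

lemma charpoly_coeff_palindromic_of_isometry [IsDomain R] {h : ℕ} (hι : Fintype.card ι = 2 * h)
    {M Φ : Matrix ι ι R} (hM : Mᵀ * Φ * M = Φ) (hΦ : Φ.det ≠ 0) (hdet : M.det = 1) (i j : ℕ)
    (hij : i + j = 2 * h) : M.charpoly.coeff i = M.charpoly.coeff j := by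
  conv_lhs => rw [charpoly_eq_charpolyRev_of_isometry hι hM hΦ hdet, ← reverse_charpoly,
    coeff_reverse, charpoly_natDegree_eq_dim, hι, revAt_le (by omega)]
  congr 1
  omega

lemma isometry_pow {M Φ : Matrix ι ι R} (hM : Mᵀ * Φ * M = Φ) (j : ℕ) :
    (M ^ j)ᵀ * Φ * M ^ j = Φ := by
  induction j with
  | zero => simp
  | succ j ih =>
    rw [pow_succ, transpose_mul]
    calc Mᵀ * (M ^ j)ᵀ * Φ * (M ^ j * M) = Mᵀ * ((M ^ j)ᵀ * Φ * M ^ j) * M := by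
          simp only [mul_assoc]
      _ = Φ := by rw [ih, hM]

/-- Adjoin a root `i` of `X² + 1`. Then `1 + M² = (i - M)(-i - M)`, and the two determinants are `b
i^h` and `b (-i)^h`, where `i^h (-i)^h = 1`. -/
lemma det_one_add_sq_of_charpoly [IsDomain R] {h : ℕ} (M : Matrix ι ι R) (b : R) (Q : R[X]) (hP : M.charpoly = C b * X ^ h + (X ^ 2 + 1) * Q) :
    (1 + M ^ 2).det = b ^ 2 := by
  set f := AdjoinRoot.of (X ^ 2 + 1 : R[X])
  set x := AdjoinRoot.root (X ^ 2 + 1 : R[X])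
  have hx : x ^ 2 = -1 := by
    have := AdjoinRoot.eval₂_root (X ^ 2 + 1 : R[X])
    simp only [eval₂_add, eval₂_pow, eval₂_X, eval₂_one] at this
    exact eq_neg_of_add_eq_zero_left this
  have hf : Function.Injective f := by
    refine AdjoinRoot.of.injective_of_degree_ne_zero ?_
    rw [show (X ^ 2 + 1 : R[X]) = X ^ 2 + C 1 by simp, degree_X_pow_add_C two_pos]
    norm_num
  have hev (y : AdjoinRoot (X ^ 2 + 1 : R[X])) (hy : y ^ 2 = -1) :
      (scalar ι y - M.map f).det = f b * y ^ h := by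
    rw [← eval_charpoly, show M.map f = f.mapMatrix M from rfl, RingHom.mapMatrix_apply, charpoly_map,
      hP]
    simp [hy]
  apply hf
  have hy := hev (-x) (by rw [neg_sq, hx])
  have hmul : (scalar ι x - M.map f) * (scalar ι (-x) - M.map f) = (1 + M ^ 2).map f := by
    have h1 : (1 + M ^ 2).map f = 1 + M.map f * M.map f := by
      rw [← RingHom.mapMatrix_apply, map_add, map_one, map_pow, RingHom.mapMatrix_apply, pow_two (M.map f)]
    have h2 : scalar ι x * scalar ι x = -1 := by
      rw [← map_mul, ← pow_two, hx, map_neg, map_one]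
    have h3 := scalar_commute x (fun _ => Commute.all _ _) (M.map f)
    rw [h1, map_neg, sub_mul, mul_sub, mul_sub, mul_neg, mul_neg, h2, h3.eq]
    abel
  rw [RingHom.map_det, RingHom.mapMatrix_apply, ← hmul, det_mul, hev x hx, hy, map_pow]
  have : x ^ h * (-x) ^ h = 1 := by
    rw [← mul_pow, mul_neg, ← pow_two, hx, neg_neg, one_pow]
  linear_combination f b ^ 2 * this

lemma det_one_sub_pow_two_pow (M : Matrix ι ι R) (m : ℕ) :
    (1 - M ^ 2 ^ m).det = (1 - M).det * ∏ k ∈ Finset.range m, (1 + M ^ 2 ^ k).det := by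
  induction m with
  | zero => simp
  | succ m ih =>
    rw [Finset.prod_range_succ, ← mul_assoc, ← ih, ← det_mul]
    congr 1
    rw [pow_succ 2 m, pow_mul, sub_mul, mul_add, mul_add]
    simp only [one_mul, mul_one, pow_two]
    abel

end Palindromic

/-! ### The unreduced Burau matrix and its comparison with the reduced one. -/

section UnreducedBurau

open Matrix

variable {R S : Type*} [CommRing R] [CommRing S] {n : ℕ}

/-- The lower position of the generator `σ_i`. -/
def lowStrand (i : Fin (n - 1)) : Fin n := ⟨i, by omega⟩

/-- The upper position of the generator `σ_i`. -/
def highStrand (i : Fin (n - 1)) : Fin n := ⟨i + 1, by omega⟩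

lemma highStrand_injective : Function.Injective (highStrand (n := n)) := by
  intro i j h
  have := congrArg Fin.val h
  simp only [highStrand, Nat.add_right_cancel_iff] at this
  exact Fin.ext this

lemma highStrand_ne_zero [NeZero n] (i : Fin (n - 1)) : highStrand i ≠ 0 := by
  intro h
  have := congrArg Fin.val h
  simp [highStrand] at this

lemma sum_univ_highStrand [NeZero n] (f : Fin n → R) :
    ∑ p, f p = f 0 + ∑ i : Fin (n - 1), f (highStrand i) := by
  obtain ⟨N, rfl⟩ : ∃ N, n = N + 1 := ⟨n - 1, by have := NeZero.pos n; omega⟩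
  exact Fin.sum_univ_succ f

/-- The unreduced Burau matrix of a letter of a braid word: it expresses the variables above the
crossing by those below it. -/
def burauStep (t : Rˣ) (l : Fin (n - 1) × Bool) : Matrix (Fin n) (Fin n) R :=
  1 + (if l.2 then 1 else ((t⁻¹ : Rˣ) : R)) •
    vecMulVec (Pi.single (lowStrand l.1) (t : R) - Pi.single (highStrand l.1) 1)
      (Pi.single (highStrand l.1) 1 - Pi.single (lowStrand l.1) 1)

/-- The unreduced Burau matrix of a braid word. -/
def burauWord (t : Rˣ) : BraidWord n → Matrix (Fin n) (Fin n) R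
  | [] => 1
  | l :: v => burauWord t v * burauStep t l

lemma burauWord_append (t : Rˣ) (u v : BraidWord n) :
    burauWord t (u ++ v) = burauWord t v * burauWord t u := by
  induction u with
  | nil => simp [burauWord]
  | cons l u ih => rw [List.cons_append, burauWord, ih, burauWord, mul_assoc]

lemma burauStep_map (f : R →+* S) (t : Rˣ) (l : Fin (n - 1) × Bool) :
    (burauStep t l).map f = burauStep (Units.map (f : R →* S) t) l := by
  ext p q
  rcases l with ⟨i, b⟩
  cases b <;>
  simp [burauStep, vecMulVec_apply, one_apply, Pi.single_apply, apply_ite f, ← map_inv]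

lemma burauWord_map (f : R →+* S) (t : Rˣ) (v : BraidWord n) :
    (burauWord t v).map f = burauWord (Units.map (f : R →* S) t) v := by
  induction v with
  | nil => simp [burauWord]
  | cons l v ih => rw [burauWord, Matrix.map_mul, ih, burauStep_map, burauWord]

/-- The row factor of the rank-one term has sum zero. Thus the columns of `1 - B` add up to zero. -/
lemma burauStep_mulVec_one (t : Rˣ) (l : Fin (n - 1) × Bool) :
    burauStep t l *ᵥ (fun _ => 1) = fun _ => 1 := by
  rw [burauStep, add_mulVec, one_mulVec, smul_mulVec, vecMulVec_mulVec]
  simp [sub_dotProduct]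

/-- The weights `t^p` annihilate the column factor, as `t^i t = t^(i+1)`. This gives the dependence
between the rows of `1 - B`. -/
lemma vecMul_burauStep (t : Rˣ) (l : Fin (n - 1) × Bool) :
    (fun p : Fin n => (t : R) ^ (p : ℕ)) ᵥ* burauStep t l = fun p : Fin n => (t : R) ^ (p : ℕ) := by
  rw [burauStep, vecMul_add, vecMul_one, vecMul_smul, vecMul_vecMulVec]
  simp [dotProduct_sub, lowStrand, highStrand, pow_succ]

lemma burauWord_mulVec_one (t : Rˣ) (v : BraidWord n) :
    burauWord t v *ᵥ (fun _ => 1) = fun _ => 1 := by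
  induction v with
  | nil => simp [burauWord]
  | cons l v ih => rw [burauWord, ← mulVec_mulVec, burauStep_mulVec_one, ih]

lemma vecMul_burauWord (t : Rˣ) (v : BraidWord n) :
    (fun p : Fin n => (t : R) ^ (p : ℕ)) ᵥ* burauWord t v = fun p : Fin n => (t : R) ^ (p : ℕ) := by
  induction v with
  | nil => simp [burauWord]
  | cons l v ih => rw [burauWord, ← vecMul_vecMul, ih, vecMul_burauStep]

/-- The matrix of scaled differences, which intertwines the unreduced and the reduced Burau
matrices. -/
def differenceMatrix (n : ℕ) (s : Rˣ) : Matrix (Fin (n - 1)) (Fin n) R :=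
  Matrix.of fun i => (s : R) ^ (i : ℕ) • (Pi.single (highStrand i) 1 - Pi.single (lowStrand i) 1)

lemma differenceMatrix_mul_apply {κ : Type*} (s : Rˣ) (X : Matrix (Fin n) κ R) (i : Fin (n - 1))
    (j : κ) : (differenceMatrix n s * X) i j =
      (s : R) ^ (i : ℕ) * (X (highStrand i) j - X (lowStrand i) j) := by
  simp [differenceMatrix, mul_apply, Pi.single_apply, sub_mul, mul_sub, Finset.sum_sub_distrib]

/-- The reduced Burau matrix of a letter of a braid word. -/
def burauLetter (s : Rˣ) (l : Fin (n - 1) × Bool) : Matrix (Fin (n - 1)) (Fin (n - 1)) R :=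
  (burauGen (if l.2 then s else s⁻¹) l.1).val

/-- Both sides differ from the difference matrix by a rank-one term: the row factor of the step is
`s^(-k)` times the `k`-th scaled difference, and the difference matrix sends its column factor to
`-s^(k+1)` times the `k`-th row of `J`. -/
lemma differenceMatrix_mul_burauStep (s : Rˣ) (l : Fin (n - 1) × Bool) :
    differenceMatrix n s * burauStep (s ^ 2) l = (burauLetter s l)ᵀ * differenceMatrix n s := by
  rcases l with ⟨k, b⟩
  ext i p
  have hs := s.mul_inv
  have e1 : ((burauLetter s (k, b))ᵀ * differenceMatrix n s) i p = differenceMatrix n s i p -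
      (if b then (s : R) else (s⁻¹ : Rˣ)) * burauForm (n - 1) s k i * differenceMatrix n s k p := by
    have : (burauLetter s (k, b))ᵀ = 1 - (if b then (s : R) else (s⁻¹ : Rˣ)) •
        (temperleyLieb s k)ᵀ := by
      cases b <;> simp [burauLetter, burauGen, temperleyLieb_inv]
    rw [this, Matrix.sub_mul, Matrix.one_mul, Matrix.smul_mul, Matrix.sub_apply, Matrix.smul_apply,
      mul_apply]
    simp [temperleyLieb_apply, mul_assoc]
  have e2 : (differenceMatrix n s * burauStep (s ^ 2) (k, b) : Matrix _ _ R) i p = differenceMatrix n s i p +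
      (if b then 1 else ((s⁻¹ : Rˣ) : R) ^ 2) * (differenceMatrix n s *ᵥ
        (Pi.single (lowStrand k) ((s : R) ^ 2) - Pi.single (highStrand k) 1)) i *
        (Pi.single (highStrand k) 1 - Pi.single (lowStrand k) 1 : Fin n → R) p := by
    rw [burauStep, Matrix.mul_add, Matrix.mul_one, Matrix.mul_smul, mul_vecMulVec]
    cases b <;> simp [vecMulVec_apply, mul_assoc]
  have e3 : (differenceMatrix n s *ᵥ
        (Pi.single (lowStrand k) ((s : R) ^ 2) - Pi.single (highStrand k) 1)) i =
      -((s : R) * s ^ (k : ℕ) * burauForm (n - 1) s k i) := by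
    have : (differenceMatrix n s *ᵥ
        (Pi.single (lowStrand k) ((s : R) ^ 2) - Pi.single (highStrand k) 1)) i =
        (s : R) ^ (i : ℕ) * ((if (i : ℕ) + 1 = k then (s : R) ^ 2 else 0) -
          (if i = k then 1 else 0) - ((if i = k then (s : R) ^ 2 else 0) -
            if (k : ℕ) + 1 = i then 1 else 0)) := by
      change ((s : R) ^ (i : ℕ) • (Pi.single (highStrand i) 1 - Pi.single (lowStrand i) 1 : Fin n → R)) ⬝ᵥ
        _ = _
      rw [smul_dotProduct, sub_dotProduct, single_dotProduct, single_dotProduct]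
      simp only [Pi.sub_apply, Pi.single_apply, highStrand, lowStrand, one_mul,
        smul_eq_mul, Nat.add_right_cancel_iff, Fin.ext_iff, eq_comm (a := (i : ℕ)) (b := k + 1)]
    rw [this, burauForm, of_apply]
    rcases eq_or_ne i k with rfl | h
    · simp
      linear_combination (s : R) ^ (i : ℕ) * hs
    · rw [if_neg h, if_neg h, if_neg h.symm]
      by_cases h1 : (i : ℕ) + 1 = k
      · rw [if_pos h1, if_neg (by omega), if_pos (.inr h1), ← h1]
        ring
      · by_cases h2 : (k : ℕ) + 1 = i
        · rw [if_neg h1, if_pos h2, if_pos (.inl h2), ← h2]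
          ring
        · rw [if_neg h1, if_neg h2, if_neg (by tauto)]
          ring
  have e4 : differenceMatrix n s k p = (s : R) ^ (k : ℕ) *
      (Pi.single (highStrand k) 1 - Pi.single (lowStrand k) 1 : Fin n → R) p := rfl
  rw [e1, e2, e3, e4]
  cases b
  · simp only [Bool.false_eq_true, if_false]
    linear_combination (-((s⁻¹ : Rˣ) : R) * (s : R) ^ (k : ℕ) * burauForm (n - 1) s k i *
      (Pi.single (highStrand k) 1 - Pi.single (lowStrand k) 1 : Fin n → R) p) * hs
  · simp only [if_true]
    ring

lemma burauLetter_eq (s : Rˣ) (l : Fin (n - 1) × Bool) :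
    burauLetter s l = (burau n s (BraidWord.toBraid [l])).val := by
  rcases l with ⟨k, b⟩
  cases b
  · have : BraidWord.toBraid [(k, false)] = (BraidGroup.σ k : BraidGroup n)⁻¹ := rfl
    rw [this, map_inv, burau_σ, burauGen_inv]
    rfl
  · have : BraidWord.toBraid [(k, true)] = (BraidGroup.σ k : BraidGroup n) := rfl
    rw [this, burau_σ]
    rfl

/-- The transpose reconciles the orders: `burauWord` multiplies the letters from right to left,
`burau` from left to right. -/
lemma differenceMatrix_mul_burauWord (s : Rˣ) (v : BraidWord n) :
    differenceMatrix n s * burauWord (s ^ 2) v =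
      (burau n s v.toBraid).valᵀ * differenceMatrix n s := by
  induction v with
  | nil =>
    have : BraidWord.toBraid ([] : BraidWord n) = 1 := rfl
    rw [burauWord, this]
    simp
  | cons l v ih =>
    have : BraidWord.toBraid (l :: v) = BraidWord.toBraid [l] * BraidWord.toBraid v := by
      rw [BraidWord.toBraid, BraidWord.toBraid, BraidWord.toBraid, ← map_mul, FreeGroup.mul_mk]
      rfl
    rw [burauWord, ← Matrix.mul_assoc, ih, Matrix.mul_assoc, differenceMatrix_mul_burauStep, this,
      map_mul, Units.val_mul, transpose_mul, burauLetter_eq, Matrix.mul_assoc]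

/-- The minor of `1 - B` with the first row and the first column deleted, where `B` is the
unreduced Burau matrix. -/
def burauMinor (t : Rˣ) (v : BraidWord n) : R :=
  ((1 - burauWord t v).submatrix highStrand highStrand).det

lemma burauMinor_map (f : R →+* S) (t : Rˣ) (v : BraidWord n) :
    f (burauMinor t v) = burauMinor (Units.map (f : R →* S) t) v := by
  rw [burauMinor, burauMinor, RingHom.map_det, ← burauWord_map f]
  congr 1
  ext i j
  simp [one_apply, apply_ite f]

lemma one_sub_burauWord_row_zero [NeZero n] (t : Rˣ) (v : BraidWord n) (q : Fin n) :
    (1 - burauWord t v) 0 q =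
      -∑ i : Fin (n - 1), (t : R) ^ ((i : ℕ) + 1) * (1 - burauWord t v) (highStrand i) q := by
  have h : (fun p : Fin n => (t : R) ^ (p : ℕ)) ᵥ* (1 - burauWord t v) = 0 := by
    rw [vecMul_sub, vecMul_one, vecMul_burauWord, sub_self]
  have := congrFun h q
  rw [vecMul, dotProduct, sum_univ_highStrand] at this
  simp only [Fin.val_zero, pow_zero, one_mul, Pi.zero_apply] at this
  exact eq_neg_of_add_eq_zero_left this

lemma one_sub_burauWord_col_zero [NeZero n] (t : Rˣ) (v : BraidWord n) (p : Fin n) :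
    (1 - burauWord t v) p 0 = -∑ i : Fin (n - 1), (1 - burauWord t v) p (highStrand i) := by
  have h : (1 - burauWord t v) *ᵥ (fun _ => (1 : R)) = 0 := by
    rw [sub_mulVec, one_mulVec, burauWord_mulVec_one, sub_self]
  have := congrFun h p
  rw [mulVec, dotProduct, sum_univ_highStrand] at this
  simp only [mul_one, Pi.zero_apply] at this
  exact eq_neg_of_add_eq_zero_left this

lemma isUnit_det_differenceMatrix (s : Rˣ) :
    IsUnit ((differenceMatrix n s).submatrix id highStrand).det := by
  rw [det_of_isLowerTriangular]
  · rw [IsUnit.prod_univ_iff]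
    intro i
    have : highStrand i ≠ lowStrand i := by simp [highStrand, lowStrand]
    simpa [differenceMatrix, this] using s.isUnit.pow _
  · intro i j hij
    have hij' : i < j := hij
    have h1 : highStrand j ≠ highStrand i := highStrand_injective.ne hij'.ne'
    have h2 : highStrand j ≠ lowStrand i := by
      simp only [highStrand, lowStrand, ne_eq, Fin.mk.injEq]
      omega
    simp [differenceMatrix, h1, h2]

/-- The relation between the determinants of the reduced and of the unreduced Burau matrices. -/
lemma det_one_sub_burau [NeZero n] (s : Rˣ) (v : BraidWord n) :
    (1 - (burau n s v.toBraid).val).det =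
      (∑ i ∈ Finset.range n, ((s : R) ^ 2) ^ i) * burauMinor (s ^ 2) v := by
  set B := burauWord (s ^ 2) v
  set D := (1 - B).submatrix highStrand highStrand with hD
  set d := differenceMatrix n s
  set y : Fin (n - 1) → R := fun j => ((s : R) ^ 2) ^ ((j : ℕ) + 1)
  -- Row 0 of `1 - B` is minus the sum of the other rows with weights `t^(i+1)`, so `Y * D` is `D`
  -- with row 0 subtracted from every row.
  set Y := 1 + replicateCol Unit (fun _ : Fin (n - 1) => (1 : R)) * replicateRow Unit y
  have hY : Y.det = ∑ i ∈ Finset.range n, ((s : R) ^ 2) ^ i := by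
    rw [det_one_add_replicateCol_mul_replicateRow]
    have hn : n - 1 + 1 = n := by have := NeZero.pos n; omega
    conv_rhs => rw [← hn, Finset.sum_range_succ', pow_zero, add_comm]
    simp only [dotProduct, mul_one, y]
    rw [Fin.sum_univ_eq_sum_range (fun j => ((s : R) ^ 2) ^ (j + 1))]
  have key : (1 - (burau n s v.toBraid).valᵀ) * d.submatrix id highStrand =
      d.submatrix id highStrand * Y * D := by
    -- Subtracting row 0 from all rows is invisible to the difference matrix, and it makes row 0
    -- vanish, so that only square blocks remain.
    set X : Matrix (Fin n) (Fin (n - 1)) R :=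
      Matrix.of fun p j => (1 - B) p (highStrand j) - (1 - B) 0 (highStrand j) with hX
    have h1 : (1 - (burau n s v.toBraid).valᵀ) * d.submatrix id highStrand = d * X := by
      have h2 : (1 - (burau n s v.toBraid).valᵀ) * d = d * (1 - B) := by
        rw [Matrix.sub_mul, Matrix.mul_sub, Matrix.one_mul, Matrix.mul_one,
          differenceMatrix_mul_burauWord]
      ext i j
      have h3 : ((1 - (burau n s v.toBraid).valᵀ) * d.submatrix id highStrand) i j =
          (d * (1 - B) : Matrix _ _ R) i (highStrand j) := by
        rw [← h2]
        rfl
      rw [h3, differenceMatrix_mul_apply, differenceMatrix_mul_apply]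
      simp [hX]
    have h2 : Y * D = X.submatrix highStrand id := by
      ext i j
      simp only [Y, Matrix.add_mul, Matrix.one_mul, Matrix.mul_assoc, Matrix.add_apply, hX]
      rw [mul_apply, submatrix_apply, of_apply, one_sub_burauWord_row_zero]
      simp [hD, mul_apply, y, B]
    rw [h1, Matrix.mul_assoc, h2]
    ext i j
    rw [mul_apply, sum_univ_highStrand, mul_apply]
    simp [hX]
  have h := congrArg det key
  rw [det_mul, det_mul, det_mul, mul_comm, mul_assoc] at h
  rw [← det_transpose, transpose_sub, transpose_one, (isUnit_det_differenceMatrix s).mul_left_cancel h,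
    hY]
  rfl

end UnreducedBurau

/-! ### The ideal of submaximal minors and its behaviour under matrix operations. -/

section AdjugateIdeal

open Matrix

variable {R : Type*} [CommRing R] {ι κ : Type*} [Fintype ι] [DecidableEq ι] [Fintype κ]
  [DecidableEq κ]

/-- The ideal that is generated by the entries of the adjugate of a square matrix. -/
def adjugateIdeal (M : Matrix ι ι R) : Ideal R :=
  Ideal.span {x | ∃ i j, x = M.adjugate i j}

lemma adjugate_apply_mem_adjugateIdeal (M : Matrix ι ι R) (i j : ι) :
    M.adjugate i j ∈ adjugateIdeal M :=
  Ideal.subset_span ⟨i, j, rfl⟩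

lemma adjugateIdeal_mul_le_left (P M : Matrix ι ι R) : adjugateIdeal (P * M) ≤ adjugateIdeal M := by
  refine Ideal.span_le.2 ?_
  rintro x ⟨i, j, rfl⟩
  rw [adjugate_mul_distrib, mul_apply]
  exact sum_mem fun k _ => Ideal.mul_mem_right _ _ (adjugate_apply_mem_adjugateIdeal M i k)

lemma adjugateIdeal_mul_le_right (M Q : Matrix ι ι R) :
    adjugateIdeal (M * Q) ≤ adjugateIdeal M := by
  refine Ideal.span_le.2 ?_
  rintro x ⟨i, j, rfl⟩
  rw [adjugate_mul_distrib, mul_apply]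
  exact sum_mem fun k _ => Ideal.mul_mem_left _ _ (adjugate_apply_mem_adjugateIdeal M k j)

lemma adjugateIdeal_mul_left {P : Matrix ι ι R} (hP : IsUnit P.det) (M : Matrix ι ι R) :
    adjugateIdeal (P * M) = adjugateIdeal M := by
  refine le_antisymm (adjugateIdeal_mul_le_left P M) ?_
  conv_lhs => rw [← Matrix.one_mul M, ← nonsing_inv_mul P hP, Matrix.mul_assoc]
  exact adjugateIdeal_mul_le_left _ _

lemma adjugateIdeal_mul_right {Q : Matrix ι ι R} (hQ : IsUnit Q.det) (M : Matrix ι ι R) :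
    adjugateIdeal (M * Q) = adjugateIdeal M := by
  refine le_antisymm (adjugateIdeal_mul_le_right M Q) ?_
  conv_lhs => rw [← Matrix.mul_one M, ← mul_nonsing_inv Q hQ, ← Matrix.mul_assoc]
  exact adjugateIdeal_mul_le_right _ _

lemma adjugateIdeal_submatrix_equiv (e : κ ≃ ι) (M : Matrix ι ι R) :
    adjugateIdeal (M.submatrix e e) = adjugateIdeal M := by
  rw [adjugateIdeal, adjugateIdeal, adjugate_submatrix_equiv_self]
  congr 1
  ext x
  constructor
  · rintro ⟨i, j, rfl⟩
    exact ⟨e i, e j, rfl⟩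
  · rintro ⟨i, j, rfl⟩
    exact ⟨e.symm i, e.symm j, by simp⟩

/-- The entries are computed as determinants with one row replaced, without inverting anything,
since the formula is applied to singular blocks. -/
lemma adjugate_fromBlocks_zero_zero (A : Matrix ι ι R) (D : Matrix κ κ R) :
    (fromBlocks A 0 0 D).adjugate =
      fromBlocks (D.det • A.adjugate) 0 0 (A.det • D.adjugate) := by
  have h1 (j : ι) (u : ι → R) (u' : κ → R) :
      (fromBlocks A 0 0 D).updateRow (Sum.inl j) (Sum.elim u u') =
      fromBlocks (A.updateRow j u) (updateRow 0 j u') 0 D := by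
    ext (a | a) (b | b) <;> simp [updateRow_apply]
  have h2 (j : κ) (u : ι → R) (u' : κ → R) :
      (fromBlocks A 0 0 D).updateRow (Sum.inr j) (Sum.elim u u') =
      fromBlocks A 0 (updateRow 0 j u) (D.updateRow j u') := by
    ext (a | a) (b | b) <;> simp [updateRow_apply]
  have e1 (i : ι) : (Pi.single (Sum.inl i) 1 : ι ⊕ κ → R) = Sum.elim (Pi.single i 1) (0 : κ → R) := by
    ext (a | a) <;> simp [Pi.single_apply]
  have e2 (i : κ) : (Pi.single (Sum.inr i) 1 : ι ⊕ κ → R) = Sum.elim (0 : ι → R) (Pi.single i 1) := by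
    ext (a | a) <;> simp [Pi.single_apply]
  have z1 (j : ι) : (A.updateRow j 0).det = 0 := det_eq_zero_of_row_eq_zero j (by simp)
  have z2 (j : κ) : (D.updateRow j 0).det = 0 := det_eq_zero_of_row_eq_zero j (by simp)
  ext (a | a) (b | b)
  · rw [adjugate_apply, e1, h1, det_fromBlocks_zero₂₁, fromBlocks_apply₁₁, Matrix.smul_apply,
      adjugate_apply, smul_eq_mul, mul_comm]
  · rw [adjugate_apply, e1, h2, det_fromBlocks_zero₁₂, z2, mul_zero]
    rfl
  · rw [adjugate_apply, e2, h1, det_fromBlocks_zero₂₁, z1, zero_mul]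
    rfl
  · rw [adjugate_apply, e2, h2, det_fromBlocks_zero₁₂, fromBlocks_apply₂₂, Matrix.smul_apply,
      adjugate_apply, smul_eq_mul]

lemma det_mem_adjugateIdeal [Nonempty ι] (M : Matrix ι ι R) : M.det ∈ adjugateIdeal M := by
  obtain ⟨i⟩ := ‹Nonempty ι›
  rw [det_eq_sum_mul_adjugate_row M i]
  exact sum_mem fun k _ => Ideal.mul_mem_left _ _ (adjugate_apply_mem_adjugateIdeal M k i)

/-- A block triangular matrix whose second diagonal block is invertible has the same adjugate ideal
as its first diagonal block. -/
lemma adjugateIdeal_fromBlocks [Nonempty ι] (A : Matrix ι ι R) (B : Matrix ι κ R)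
    {D : Matrix κ κ R} (hD : IsUnit D.det) :
    adjugateIdeal (fromBlocks A B 0 D) = adjugateIdeal A := by
  have h1 : fromBlocks A B 0 D = fromBlocks 1 B 0 D * fromBlocks A 0 0 1 := by
    simp [fromBlocks_multiply]
  rw [h1, adjugateIdeal_mul_left (by simpa using hD)]
  refine le_antisymm ?_ ?_
  · refine Ideal.span_le.2 ?_
    rintro x ⟨i | i, j | j, rfl⟩ <;> rw [adjugate_fromBlocks_zero_zero]
    · simpa using adjugate_apply_mem_adjugateIdeal A i j
    · simp
    · simp
    · simpa using Ideal.mul_mem_right _ _ (det_mem_adjugateIdeal A)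
  · refine Ideal.span_le.2 ?_
    rintro x ⟨i, j, rfl⟩
    have := adjugate_apply_mem_adjugateIdeal (fromBlocks A 0 0 (1 : Matrix κ κ R)) (.inl i) (.inl j)
    rw [adjugate_fromBlocks_zero_zero] at this
    simpa using this

/-- If the first row of a block matrix is a combination of the other rows, and the first column is a
combination of the other columns, then the adjugate ideal is generated by the complementary
minor. -/
lemma adjugateIdeal_fromBlocks_of_dependent [Unique ι] (D : Matrix κ κ R) (x : Matrix ι κ R)
    (y : Matrix κ ι R) :
    adjugateIdeal (fromBlocks (x * D * y) (x * D) (D * y) D) = Ideal.span {D.det} := by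
  have h1 : fromBlocks (x * D * y) (x * D) (D * y) D =
      fromBlocks 1 x 0 1 * fromBlocks 0 0 0 D * fromBlocks 1 0 y 1 := by
    simp [fromBlocks_multiply, Matrix.mul_assoc]
  rw [h1, adjugateIdeal_mul_right (by simp), adjugateIdeal_mul_left (by simp)]
  have h0 : (0 : Matrix ι ι R).det = 0 := by simp
  refine le_antisymm ?_ ?_
  · refine Ideal.span_le.2 ?_
    rintro x ⟨i | i, j | j, rfl⟩ <;> rw [adjugate_fromBlocks_zero_zero]
    · rw [fromBlocks_apply₁₁, Matrix.smul_apply, smul_eq_mul]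
      exact Ideal.mul_mem_right _ _ (Ideal.mem_span_singleton_self _)
    · simp
    · simp
    · simp
  · rw [Ideal.span_singleton_le_iff_mem]
    have := adjugate_apply_mem_adjugateIdeal (fromBlocks (0 : Matrix ι ι R) 0 0 D) (.inl default)
      (.inl default)
    rw [adjugate_fromBlocks_zero_zero] at this
    simpa [adjugate_subsingleton] using this

lemma exists_eq_succAbove_comp {k : ℕ} {r : Fin k → Fin (k + 1)} (hr : Function.Injective r) :
    ∃ (x : Fin (k + 1)) (π : Equiv.Perm (Fin k)), r = x.succAbove ∘ π := by
  obtain ⟨x, hx⟩ : ∃ x, ∀ i, r i ≠ x := by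
    by_contra! h
    have := Fintype.card_le_of_surjective r h
    simp at this
  choose π hπ using fun i => Fin.exists_succAbove_eq (hx i)
  have hinj : Function.Injective π := by
    intro i j hij
    apply hr
    rw [← hπ i, ← hπ j, hij]
  exact ⟨x, Equiv.ofBijective π (Finite.injective_iff_bijective.1 hinj), funext fun i => (hπ i).symm⟩

/-- With a repeated row or column index the minor vanishes; otherwise exactly one row and one column
are omitted, and the minor is an entry of the adjugate up to sign. -/
lemma det_submatrix_mem_adjugateIdeal_fin {k : ℕ} (M : Matrix (Fin (k + 1)) (Fin (k + 1)) R)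
    (r c : Fin k → Fin (k + 1)) : (M.submatrix r c).det ∈ adjugateIdeal M := by
  by_cases hr : Function.Injective r
  · by_cases hc : Function.Injective c
    · obtain ⟨x, π, rfl⟩ := exists_eq_succAbove_comp hr
      obtain ⟨y, π', rfl⟩ := exists_eq_succAbove_comp hc
      have h := adjugate_fin_succ_eq_det_submatrix M y x
      have h' : (M.submatrix x.succAbove y.succAbove).det ∈ adjugateIdeal M := by
        have := Ideal.mul_mem_left _ ((-1) ^ (x + y : ℕ)) (adjugate_apply_mem_adjugateIdeal M y x)
        rwa [h, ← mul_assoc, ← mul_pow, neg_one_mul, neg_neg, one_pow, one_mul] at this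
      have e : M.submatrix (x.succAbove ∘ π) (y.succAbove ∘ π') =
          ((M.submatrix x.succAbove y.succAbove).submatrix π id).submatrix id π' := rfl
      rw [e, det_permute', det_permute]
      exact Ideal.mul_mem_left _ _ (Ideal.mul_mem_left _ _ h')
    · obtain ⟨i, j, hij, hne⟩ : ∃ i j, c i = c j ∧ i ≠ j := by
        simpa [Function.Injective] using hc
      rw [det_zero_of_column_eq hne (by simp [hij])]
      exact zero_mem _
  · obtain ⟨i, j, hij, hne⟩ : ∃ i j, r i = r j ∧ i ≠ j := by
      simpa [Function.Injective] using hr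
    rw [det_zero_of_row_eq hne (by ext; simp [hij])]
    exact zero_mem _

/-- The ideal of the minors of order `#ι - 1` of a square matrix is its adjugate ideal. -/
lemma span_minors_eq_adjugateIdeal [Nonempty ι] (M : Matrix ι ι R) :
    Ideal.span {d | ∃ (r : Fin (Fintype.card ι - 1) → ι → R) (c : Fin (Fintype.card ι - 1) → ι),
      (∀ i, ∃ a, r i = M a) ∧ d = (Matrix.of fun i j => r i (c j)).det} = adjugateIdeal M := by
  obtain ⟨k, hk⟩ : ∃ k, Fintype.card ι = k + 1 :=
    ⟨Fintype.card ι - 1, by have := Fintype.card_pos (α := ι); omega⟩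
  obtain ⟨e⟩ : Nonempty (Fin (k + 1) ≃ ι) := ⟨(Fintype.equivFinOfCardEq hk).symm⟩
  have hk' : Fintype.card ι - 1 = k := by omega
  rw [← adjugateIdeal_submatrix_equiv e]
  generalize Fintype.card ι - 1 = k' at *
  subst hk'
  refine le_antisymm (Ideal.span_le.2 ?_) (Ideal.span_le.2 ?_)
  · rintro d ⟨r, c, hr, rfl⟩
    choose ρ hρ using hr
    have := det_submatrix_mem_adjugateIdeal_fin (M.submatrix e e) (e.symm ∘ ρ) (e.symm ∘ c)
    have e' : (Matrix.of fun i j => r i (c j)) =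
        (M.submatrix e e).submatrix (e.symm ∘ ρ) (e.symm ∘ c) := by
      ext i j
      simp [hρ]
    rwa [SetLike.mem_coe, e']
  · rintro d ⟨i, j, rfl⟩
    rw [adjugate_fin_succ_eq_det_submatrix]
    refine Ideal.mul_mem_left _ _ (Ideal.subset_span ⟨fun a => M (e (j.succAbove a)),
      fun b => e (i.succAbove b), fun a => ⟨_, rfl⟩, rfl⟩)

end AdjugateIdeal

/-! ### The Alexander ideal of a closed braid. -/

section ClosureAlexander

open Matrix

variable {n : ℕ}

section Minor

variable {R : Type*} [CommRing R]

/-- The row and column dependences express row 0 and column 0 by the others, so a single minor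
generates. -/
lemma adjugateIdeal_one_sub_burauWord [NeZero n] (t : Rˣ) (v : BraidWord n) :
    adjugateIdeal (1 - burauWord t v) = Ideal.span {burauMinor t v} := by
  have hbij : Function.Bijective
      (Sum.elim (fun _ => 0) highStrand : Unit ⊕ Fin (n - 1) → Fin n) := by
    rw [Fintype.bijective_iff_injective_and_card]
    constructor
    · rintro (a | a) (b | b) h
      · rfl
      · exact absurd h.symm (highStrand_ne_zero b)
      · exact absurd h (highStrand_ne_zero a)
      · exact congrArg Sum.inr (highStrand_injective h)
    · have := NeZero.pos n
      simp
      omega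
  rw [← adjugateIdeal_submatrix_equiv (Equiv.ofBijective _ hbij)]
  set D := (1 - burauWord t v).submatrix highStrand highStrand with hD
  let x : Matrix Unit (Fin (n - 1)) R := Matrix.of fun _ i => -(t : R) ^ ((i : ℕ) + 1)
  let y : Matrix (Fin (n - 1)) Unit R := Matrix.of fun _ _ => -1
  have h1 (j : Fin (n - 1)) : (x * D : Matrix _ _ R) () j = (1 - burauWord t v) 0 (highStrand j) := by
    rw [one_sub_burauWord_row_zero, mul_apply]
    simp [x, hD]
  have h2 (i : Fin (n - 1)) : (D * y : Matrix _ _ R) i () = (1 - burauWord t v) (highStrand i) 0 := by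
    rw [one_sub_burauWord_col_zero, mul_apply]
    simp [y, hD]
  have h3 : (x * D * y : Matrix _ _ R) () () = (1 - burauWord t v) 0 0 := by
    rw [one_sub_burauWord_col_zero, mul_apply]
    simp only [h1]
    simp [y]
  have : (1 - burauWord t v).submatrix (Equiv.ofBijective _ hbij) (Equiv.ofBijective _ hbij) =
      fromBlocks (x * D * y) (x * D) (D * y) D := by
    ext (a | a) (b | b)
    · exact h3.symm
    · exact (h1 b).symm
    · exact (h2 a).symm
    · rfl
  rw [this, adjugateIdeal_fromBlocks_of_dependent]
  rfl

/-- A row vector on the edges of one level of the closure of a braid. -/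
def levelVector {L : ℕ} (k : Fin L) (r : Fin n → R) : Fin n × Fin L → R :=
  fun e => if e.2 = k then r e.1 else 0

lemma levelVector_single {L : ℕ} (k : Fin L) (p : Fin n) (a : R) :
    levelVector k (Pi.single p a) = Pi.single (p, k) a := by
  ext ⟨q, l⟩
  simp only [levelVector, Pi.single_apply, Prod.mk.injEq]
  by_cases h : l = k <;> simp [h]

lemma levelVector_add {L : ℕ} (k : Fin L) (r r' : Fin n → R) :
    levelVector k (r + r') = levelVector k r + levelVector k r' := by
  ext ⟨q, l⟩
  by_cases h : l = k <;> simp [levelVector, h]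

/-- The relations of the closure of a braid, solved for the edges of the higher level. -/
def closureMatrix (t : Rˣ) (v : BraidWord n) :
    Matrix (Fin n × Fin (v.length + 1)) (Fin n × Fin (v.length + 1)) R :=
  Matrix.of fun e => Fin.cases (Pi.single (e.1, 0) 1 - Pi.single (e.1, Fin.last _) 1)
    (fun k => Pi.single (e.1, k.succ) 1 - levelVector k.castSucc (burauStep t (v.get k) e.1)) e.2

/-- The unreduced Burau matrix of the first letters of a braid word. -/
def burauPrefix (t : Rˣ) (v : BraidWord n) (k : ℕ) : Matrix (Fin n) (Fin n) R :=
  burauWord t (v.take k)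

lemma burauPrefix_succ (t : Rˣ) (v : BraidWord n) (k : Fin v.length) :
    burauPrefix t v (k + 1) = burauStep t (v.get k) * burauPrefix t v k := by
  rw [burauPrefix, List.take_add_one, burauWord_append, burauPrefix, List.getElem?_eq_getElem k.2]
  simp [burauWord]

/-- The edges of the closure of a braid, split into those of the level `0` and the other ones. -/
def closureEdgeEquiv (n L : ℕ) : Fin n ⊕ (Fin n × Fin L) ≃ Fin n × Fin (L + 1) where
  toFun := Sum.elim (fun p => (p, 0)) fun e => (e.1, e.2.succ)
  invFun e := Fin.cases (.inl e.1) (fun k => .inr (e.1, k)) e.2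
  left_inv := by rintro (p | ⟨p, k⟩) <;> rfl
  right_inv := by
    rintro ⟨p, k⟩
    cases k using Fin.cases <;> rfl

lemma closureMatrix_mulVec_zero (t : Rˣ) (v : BraidWord n) (x : Fin n × Fin (v.length + 1) → R)
    (p : Fin n) : (closureMatrix t v *ᵥ x) (p, 0) = x (p, 0) - x (p, Fin.last _) := by
  change (Pi.single (p, 0) 1 - Pi.single (p, Fin.last _) 1) ⬝ᵥ x = _
  rw [sub_dotProduct, single_one_dotProduct, single_one_dotProduct]

lemma closureMatrix_mulVec_succ (t : Rˣ) (v : BraidWord n) (x : Fin n × Fin (v.length + 1) → R)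
    (p : Fin n) (k : Fin v.length) : (closureMatrix t v *ᵥ x) (p, k.succ) =
      x (p, k.succ) - (burauStep t (v.get k) *ᵥ fun q => x (q, k.castSucc)) p := by
  change (Pi.single (p, k.succ) 1 - levelVector k.castSucc (burauStep t (v.get k) p)) ⬝ᵥ x = _
  rw [sub_dotProduct, single_one_dotProduct]
  congr 1
  simp [levelVector, dotProduct, mulVec, Fintype.sum_prod_type]

/-- Each relation involves only its own level and the one below: the matrix is block triangular by
level, with identity blocks on the diagonal. -/
lemma det_closureMatrix_higher (t : Rˣ) (v : BraidWord n) :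
    ((closureMatrix t v).submatrix (closureEdgeEquiv n v.length ∘ Sum.inr)
      (closureEdgeEquiv n v.length ∘ Sum.inr)).det = 1 := by
  set D := (closureMatrix t v).submatrix (closureEdgeEquiv n v.length ∘ Sum.inr)
      (closureEdgeEquiv n v.length ∘ Sum.inr)
  have hD (p q : Fin n) (k l : Fin v.length) : D (p, k) (q, l) =
      (if q = p ∧ l = k then 1 else 0) -
        if l.succ = k.castSucc then burauStep t (v.get k) p q else 0 := by
    change (Pi.single (p, k.succ) 1 - levelVector k.castSucc (burauStep t (v.get k) p) :
      Fin n × Fin (v.length + 1) → R) (q, l.succ) = _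
    simp [Pi.single_apply, levelVector]
  have htri : D.BlockTriangular fun e => OrderDual.toDual e.2 := by
    rintro ⟨p, k⟩ ⟨q, l⟩ h
    have h' : k < l := h
    rw [hD, if_neg (fun h => h'.ne' h.2), if_neg, sub_zero]
    rw [Fin.ext_iff, Fin.val_succ, Fin.val_castSucc]
    omega
  rw [htri.det_fintype]
  refine Finset.prod_eq_one fun k _ => ?_
  have : D.toSquareBlock (fun e => OrderDual.toDual e.2) k = 1 := by
    ext ⟨⟨p, i⟩, hi⟩ ⟨⟨q, j⟩, hj⟩
    have hij : i = j := congrArg OrderDual.ofDual (hi.trans hj.symm)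
    subst hij
    rw [toSquareBlock_def, of_apply, hD, if_neg (c := i.succ = i.castSucc) (by rw [Fin.ext_iff]; simp),
      sub_zero, one_apply]
    simp [eq_comm]
  rw [this, det_one]

/-- The unimodular column operation `Q` propagates the level 0 variables upwards by the matrices of
the prefixes. All relations above level 0 then vanish on these columns, and the closing relations
become `1 - B`. -/
lemma adjugateIdeal_closureMatrix [NeZero n] (t : Rˣ) (v : BraidWord n) :
    adjugateIdeal (closureMatrix t v) = Ideal.span {burauMinor t v} := by
  rw [← adjugateIdeal_one_sub_burauWord]
  set e := closureEdgeEquiv n v.length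
  let Q : Matrix (Fin n × Fin (v.length + 1)) (Fin n ⊕ (Fin n × Fin v.length)) R :=
    Matrix.of fun x y => Sum.elim (fun a => burauPrefix t v x.2 x.1 a)
      (fun b => if x = e (.inr b) then 1 else 0) y
  have hQ : (Q.submatrix e id).det = 1 := by
    have : Q.submatrix e id = fromBlocks 1 0 (Q.submatrix (e ∘ Sum.inr) Sum.inl) 1 := by
      ext (a | a) (b | b)
      · simp [Q, e, closureEdgeEquiv, burauPrefix, burauWord]
      · simp [Q]
      · rfl
      · simp [Q, one_apply]
    rw [this, det_fromBlocks_zero₁₂, det_one, det_one, one_mul]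
  have key : (closureMatrix t v).submatrix e e * Q.submatrix e id =
      fromBlocks (1 - burauWord t v)
        ((closureMatrix t v).submatrix (e ∘ Sum.inl) (e ∘ Sum.inr)) 0
        ((closureMatrix t v).submatrix (e ∘ Sum.inr) (e ∘ Sum.inr)) := by
    rw [submatrix_mul_equiv]
    have hl (x) (a : Fin n) : (closureMatrix t v * Q : Matrix _ _ R) x (.inl a) =
        (closureMatrix t v *ᵥ fun x => burauPrefix t v x.2 x.1 a) x := rfl
    have hr (x) (b) : (closureMatrix t v * Q : Matrix _ _ R) x (.inr b) =
        closureMatrix t v x (e (.inr b)) := by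
      simp [mul_apply, Q]
    ext (a | ⟨a, k⟩) (b | b)
    · rw [submatrix_apply, id, hl, fromBlocks_apply₁₁]
      change (closureMatrix t v *ᵥ _) (a, 0) = _
      rw [closureMatrix_mulVec_zero]
      simp [burauPrefix, burauWord]
    · exact hr _ _
    · rw [submatrix_apply, id, hl, fromBlocks_apply₂₁]
      change (closureMatrix t v *ᵥ _) (a, k.succ) = _
      rw [closureMatrix_mulVec_succ, Fin.val_succ, burauPrefix_succ]
      exact sub_self _
    · exact hr _ _
  rw [← adjugateIdeal_submatrix_equiv e, ← adjugateIdeal_mul_right (Q := Q.submatrix e id)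
    (by rw [hQ]; exact isUnit_one), key, adjugateIdeal_fromBlocks]
  rw [det_closureMatrix_higher]
  exact isUnit_one

lemma burauStep_of_ne (t : Rˣ) (l : Fin (n - 1) × Bool) (p : Fin n) (h : (p : ℕ) ≠ l.1)
    (h' : (p : ℕ) ≠ l.1 + 1) : burauStep t l p = Pi.single p 1 := by
  have h1 : p ≠ lowStrand l.1 := fun e => h (congrArg Fin.val e)
  have h2 : p ≠ highStrand l.1 := fun e => h' (congrArg Fin.val e)
  ext q
  rcases l with ⟨i, b⟩
  cases b <;>
  simp [burauStep, vecMulVec_apply, h1, h2, one_apply, Pi.single_apply, eq_comm (a := q)]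

lemma highStrand_ne_lowStrand (i : Fin (n - 1)) : highStrand i ≠ lowStrand i := by
  simp [highStrand, lowStrand]

lemma burauStep_true_low (t : Rˣ) (i : Fin (n - 1)) :
    burauStep t (i, true) (lowStrand i) =
      Pi.single (lowStrand i) (1 - (t : R)) + Pi.single (highStrand i) (t : R) := by
  ext q
  have := highStrand_ne_lowStrand i
  simp [burauStep, vecMulVec_apply, one_apply, Pi.single_apply, this.symm, eq_comm (a := q)]
  split_ifs <;> ring

lemma burauStep_true_high (t : Rˣ) (i : Fin (n - 1)) :
    burauStep t (i, true) (highStrand i) = (Pi.single (lowStrand i) 1 : Fin n → R) := by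
  ext q
  have := highStrand_ne_lowStrand i
  simp [burauStep, vecMulVec_apply, one_apply, Pi.single_apply, this, eq_comm (a := q)]

lemma burauStep_false_low (t : Rˣ) (i : Fin (n - 1)) :
    burauStep t (i, false) (lowStrand i) = (Pi.single (highStrand i) 1 : Fin n → R) := by
  ext q
  have := highStrand_ne_lowStrand i
  simp [burauStep, vecMulVec_apply, one_apply, Pi.single_apply, this.symm, eq_comm (a := q)]

lemma burauStep_false_high (t : Rˣ) (i : Fin (n - 1)) :
    burauStep t (i, false) (highStrand i) = (Pi.single (lowStrand i) ((t⁻¹ : Rˣ) : R) +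
      Pi.single (highStrand i) (1 - ((t⁻¹ : Rˣ) : R)) : Fin n → R) := by
  ext q
  have := highStrand_ne_lowStrand i
  simp [burauStep, vecMulVec_apply, one_apply, Pi.single_apply, this, eq_comm (a := q)]
  split_ifs <;> ring

end Minor

/-- The unit by which the relation of an edge of the closure, solved for that edge, has to be
multiplied to obtain the relation of the diagram. -/
noncomputable def relationUnit (v : BraidWord n) (e : Fin n × Fin (v.length + 1)) : ℤ[T;T⁻¹]ˣ :=
  Fin.cases 1 (fun k => if (v.get k).2 = false ∧ e.1 = highStrand (v.get k).1 then -laurentVar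
    else 1) e.2

lemma relationUnit_zero (v : BraidWord n) (p : Fin n) : relationUnit v (p, 0) = 1 := rfl

lemma relationUnit_succ (v : BraidWord n) (p : Fin n) (k : Fin v.length) :
    relationUnit v (p, k.succ) =
      if (v.get k).2 = false ∧ p = highStrand (v.get k).1 then -laurentVar else 1 := rfl

lemma closureMatrix_zero (v : BraidWord n) (p : Fin n) :
    closureMatrix laurentVar v (p, 0) = Pi.single (p, 0) 1 - Pi.single (p, Fin.last _) 1 := rfl

lemma closureMatrix_succ (v : BraidWord n) (p : Fin n) (k : Fin v.length) :
    closureMatrix laurentVar v (p, k.succ) =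
      Pi.single (p, k.succ) 1 - levelVector k.castSucc (burauStep laurentVar (v.get k) p) := rfl

/-- Each vertex relation is solved for an edge leaving the vertex. Only at a negative crossing does
this edge carry a coefficient other than 1, namely `-t` for the outgoing lower strand. Here
`laurentVar` plays the role of `t`, not of its square root. -/
lemma relations_closure (v : BraidWord n) (r : Fin n × Fin (v.length + 1) → ℤ[T;T⁻¹]) :
    (∃ x ∈ v.closure.vertices, r ∈ x.relations) ↔
      ∃ e, r = (relationUnit v e : ℤ[T;T⁻¹]) • closureMatrix laurentVar v e := by
  have hlow (k : Fin v.length) (h : (v.get k).2 = true) :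
      (relationUnit v (lowStrand (v.get k).1, k.succ) : ℤ[T;T⁻¹]) •
        closureMatrix laurentVar v (lowStrand (v.get k).1, k.succ) =
      Pi.single (lowStrand (v.get k).1, k.succ) 1 -
        (Pi.single (lowStrand (v.get k).1, k.castSucc) (1 - LaurentPolynomial.T 1) +
          Pi.single (highStrand (v.get k).1, k.castSucc) (LaurentPolynomial.T 1)) := by
    rw [relationUnit_succ, if_neg (by simp [-List.get_eq_getElem, h]), closureMatrix_succ]
    generalize v.get k = l at *
    obtain ⟨i, b⟩ := l
    obtain rfl : b = true := h
    rw [burauStep_true_low, levelVector_add, levelVector_single, levelVector_single, Units.val_one, one_smul]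
    rfl
  have hhigh (k : Fin v.length) (h : (v.get k).2 = true) :
      (relationUnit v (highStrand (v.get k).1, k.succ) : ℤ[T;T⁻¹]) •
        closureMatrix laurentVar v (highStrand (v.get k).1, k.succ) =
      Pi.single (highStrand (v.get k).1, k.succ) 1 -
        Pi.single (lowStrand (v.get k).1, k.castSucc) 1 := by
    rw [relationUnit_succ, if_neg (by simp [-List.get_eq_getElem, h]), closureMatrix_succ]
    generalize v.get k = l at *
    obtain ⟨i, b⟩ := l
    obtain rfl : b = true := h
    rw [burauStep_true_high, levelVector_single, Units.val_one, one_smul]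
  have hlow' (k : Fin v.length) (h : (v.get k).2 = false) :
      (relationUnit v (lowStrand (v.get k).1, k.succ) : ℤ[T;T⁻¹]) •
        closureMatrix laurentVar v (lowStrand (v.get k).1, k.succ) =
      Pi.single (lowStrand (v.get k).1, k.succ) 1 -
        Pi.single (highStrand (v.get k).1, k.castSucc) 1 := by
    rw [relationUnit_succ, if_neg (by exact fun h => highStrand_ne_lowStrand _ h.2.symm), closureMatrix_succ]
    generalize v.get k = l at *
    obtain ⟨i, b⟩ := l
    obtain rfl : b = false := h
    rw [burauStep_false_low, levelVector_single, Units.val_one, one_smul]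
  have hhigh' (k : Fin v.length) (h : (v.get k).2 = false) :
      (relationUnit v (highStrand (v.get k).1, k.succ) : ℤ[T;T⁻¹]) •
        closureMatrix laurentVar v (highStrand (v.get k).1, k.succ) =
      Pi.single (lowStrand (v.get k).1, k.castSucc) 1 -
        (Pi.single (highStrand (v.get k).1, k.castSucc) (1 - LaurentPolynomial.T 1) +
          Pi.single (highStrand (v.get k).1, k.succ) (LaurentPolynomial.T 1)) := by
    rw [relationUnit_succ, if_pos ⟨h, rfl⟩, closureMatrix_succ]
    generalize v.get k = l at *
    obtain ⟨i, b⟩ := l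
    obtain rfl : b = false := h
    rw [burauStep_false_high, levelVector_add, levelVector_single, levelVector_single]
    have hs (e : Fin n × Fin (v.length + 1)) (a : ℤ[T;T⁻¹]) (x) :
        (Pi.single e a : _ → ℤ[T;T⁻¹]) x = a * if x = e then 1 else 0 := by simp [Pi.single_apply]
    ext1 x
    simp only [Pi.smul_apply, Pi.sub_apply, Pi.add_apply, smul_eq_mul, hs, Units.val_neg]
    rw [← laurentVar_val]
    linear_combination ((if x = (lowStrand i, k.castSucc) then (1 : ℤ[T;T⁻¹]) else 0) -
      if x = (highStrand i, k.castSucc) then 1 else 0) * laurentVar.mul_inv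
  have hstraight (k : Fin v.length) (p : Fin n) (h : (p : ℕ) ≠ (v.get k).1)
      (h' : (p : ℕ) ≠ (v.get k).1 + 1) : (relationUnit v (p, k.succ) : ℤ[T;T⁻¹]) •
        closureMatrix laurentVar v (p, k.succ) =
      Pi.single (p, k.succ) 1 - Pi.single (p, k.castSucc) 1 := by
    rw [relationUnit_succ, if_neg fun e => h' (congrArg Fin.val e.2), closureMatrix_succ,
      burauStep_of_ne _ _ _ h h', levelVector_single, Units.val_one, one_smul]
  constructor
  · rintro ⟨x, hx, hr⟩
    rcases hx with p | ⟨k, p, h, h'⟩ | ⟨k, p, q, hp, hq, h⟩ | ⟨k, p, q, hp, hq, h⟩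
    · refine ⟨(p, 0), ?_⟩
      rw [relationUnit_zero, Units.val_one, one_smul, closureMatrix_zero]
      exact hr
    · exact ⟨(p, k.succ), hr.trans (hstraight k p h h').symm⟩
    · obtain rfl : p = lowStrand (v.get k).1 := Fin.ext hp
      obtain rfl : q = highStrand (v.get k).1 := Fin.ext hq
      rcases hr with hr | hr
      · exact ⟨_, hr.trans (hhigh k h).symm⟩
      · exact ⟨_, hr.trans (hlow k h).symm⟩
    · obtain rfl : p = lowStrand (v.get k).1 := Fin.ext hp
      obtain rfl : q = highStrand (v.get k).1 := Fin.ext hq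
      rcases hr with hr | hr
      · exact ⟨_, hr.trans (hlow' k h).symm⟩
      · exact ⟨_, hr.trans (hhigh' k h).symm⟩
  · rintro ⟨⟨p, k⟩, rfl⟩
    induction k using Fin.cases with
    | zero =>
      refine ⟨_, .close p, ?_⟩
      rw [relationUnit_zero, Units.val_one, one_smul, closureMatrix_zero]
      rfl
    | succ k =>
      by_cases h1 : (p : ℕ) = (v.get k).1
      · obtain rfl : p = lowStrand (v.get k).1 := Fin.ext h1
        cases h : (v.get k).2
        · exact ⟨_, .negative k _ (highStrand (v.get k).1) rfl rfl h, .inl (hlow' k h)⟩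
        · exact ⟨_, .positive k _ (highStrand (v.get k).1) rfl rfl h, .inr (hlow k h)⟩
      · by_cases h2 : (p : ℕ) = (v.get k).1 + 1
        · obtain rfl : p = highStrand (v.get k).1 := Fin.ext h2
          cases h : (v.get k).2
          · exact ⟨_, .negative k (lowStrand (v.get k).1) _ rfl rfl h, .inr (hhigh' k h)⟩
          · exact ⟨_, .positive k (lowStrand (v.get k).1) _ rfl rfl h, .inl (hhigh k h)⟩
        · exact ⟨_, .straight k p h1 h2, hstraight k p h1 h2⟩

/-- The Alexander ideal of the closure of a braid is generated by a minor of `1 - B`, where `B` is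
the unreduced Burau matrix. -/
lemma alexanderIdeal_closure [NeZero n] (v : BraidWord n) :
    v.closure.alexanderIdeal = Ideal.span {burauMinor laurentVar v} := by
  have hu : IsUnit (diagonal fun e => (relationUnit v e : ℤ[T;T⁻¹])).det := by
    rw [det_diagonal, IsUnit.prod_univ_iff]
    exact fun e => (relationUnit v e).isUnit
  rw [← adjugateIdeal_closureMatrix, ← adjugateIdeal_mul_left hu, ← span_minors_eq_adjugateIdeal]
  unfold LinkDiagram.alexanderIdeal
  have hrow (e) : ((diagonal fun e => (relationUnit v e : ℤ[T;T⁻¹])) * closureMatrix laurentVar v :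
      Matrix _ _ _) e = (relationUnit v e : ℤ[T;T⁻¹]) • closureMatrix laurentVar v e := by
    ext x
    rw [diagonal_mul]
    rfl
  simp only [relations_closure, hrow]

end ClosureAlexander

/-! ### The value at `t = 1` for a knot. -/

section KnotNormalization

open Matrix

variable {n : ℕ}

/-- At `t = 1` a crossing of either sign acts as the transposition of its two strands. -/
lemma burauStep_one_mulVec_low {R : Type*} [CommRing R] (l : Fin (n - 1) × Bool) (x : Fin n → R) :
    (burauStep (1 : Rˣ) l *ᵥ x) (lowStrand l.1) = x (highStrand l.1) := by
  change burauStep (1 : Rˣ) l (lowStrand l.1) ⬝ᵥ x = _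
  obtain ⟨i, b⟩ := l
  cases b
  · rw [burauStep_false_low, single_one_dotProduct]
  · rw [burauStep_true_low, add_dotProduct, single_dotProduct, single_dotProduct]
    simp

lemma burauStep_one_mulVec_high {R : Type*} [CommRing R] (l : Fin (n - 1) × Bool) (x : Fin n → R) :
    (burauStep (1 : Rˣ) l *ᵥ x) (highStrand l.1) = x (lowStrand l.1) := by
  change burauStep (1 : Rˣ) l (highStrand l.1) ⬝ᵥ x = _
  obtain ⟨i, b⟩ := l
  cases b
  · rw [burauStep_false_high, add_dotProduct, single_dotProduct, single_dotProduct]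
    simp
  · rw [burauStep_true_high, single_one_dotProduct]

lemma burauStep_mulVec_of_ne {R : Type*} [CommRing R] (t : Rˣ) (l : Fin (n - 1) × Bool) (p : Fin n)
    (h : (p : ℕ) ≠ l.1) (h' : (p : ℕ) ≠ l.1 + 1) (x : Fin n → R) :
    (burauStep t l *ᵥ x) p = x p := by
  change burauStep t l p ⬝ᵥ x = _
  rw [burauStep_of_ne t l p h h', single_one_dotProduct]

/-- At `t = 1`, an eigenvector of the Burau matrix for the eigenvalue `1` is constant along the
closure of the braid. -/
lemma eq_of_isKnot {R : Type*} [CommRing R] (v : BraidWord n) (hK : v.closure.IsKnot)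
    (y : Fin n → R) (hy : burauWord (1 : Rˣ) v *ᵥ y = y) (p q : Fin n) : y p = y q := by
  let x : Fin n × Fin (v.length + 1) → R := fun e => (burauPrefix 1 v e.2 *ᵥ y) e.1
  have hx0 (p : Fin n) : x (p, 0) = y p := by
    simp [x, burauPrefix, burauWord]
  have hxs (k : Fin v.length) (p : Fin n) :
      x (p, k.succ) = (burauStep 1 (v.get k) *ᵥ fun q => x (q, k.castSucc)) p := by
    simp only [x, Fin.val_succ, burauPrefix_succ, ← mulVec_mulVec]
    rfl
  have hxl (p : Fin n) : x (p, Fin.last _) = y p := by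
    simp [x, burauPrefix, hy]
  have step (a b) (hab : ∃ z ∈ v.closure.vertices, z.Next a b) : x a = x b := by
    obtain ⟨z, hz, hn⟩ := hab
    rcases hz with p | ⟨k, p, h, h'⟩ | ⟨k, p, q, hp, hq, h⟩ | ⟨k, p, q, hp, hq, h⟩
    · cases hn
      rw [hxl, hx0]
    · cases hn
      rw [hxs, burauStep_mulVec_of_ne _ _ _ h h']
    · obtain rfl : p = lowStrand (v.get k).1 := Fin.ext hp
      obtain rfl : q = highStrand (v.get k).1 := Fin.ext hq
      cases hn
      · rw [hxs, burauStep_one_mulVec_high]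
      · rw [hxs, burauStep_one_mulVec_low]
    · obtain rfl : p = lowStrand (v.get k).1 := Fin.ext hp
      obtain rfl : q = highStrand (v.get k).1 := Fin.ext hq
      cases hn
      · rw [hxs, burauStep_one_mulVec_low]
      · rw [hxs, burauStep_one_mulVec_high]
  have hconst (e f) : x e = x f := by
    induction hK.2 e f with
    | refl => rfl
    | tail _ h ih => rw [ih, step _ _ h]
  rw [← hx0, ← hx0 q, hconst]

/-- A kernel vector of the minor, extended by 0 at position 0, is fixed by `B`: the missing equation
follows from the row dependence. On a knot a fixed vector is constant, hence zero. -/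
lemma burauMinor_one_ne_zero [NeZero n] {K : Type*} [Field K] (v : BraidWord n)
    (hK : v.closure.IsKnot) : burauMinor (1 : Kˣ) v ≠ 0 := by
  intro h
  obtain ⟨y, hy0, hy⟩ := exists_mulVec_eq_zero_iff.2 h
  apply hy0
  let z : Fin n → K := fun p => if hp : p = 0 then 0 else y ⟨p - 1, by
    have := Fin.val_ne_zero_iff.2 hp
    omega⟩
  have hz0 : z 0 = 0 := by simp [z]
  have hzs (i : Fin (n - 1)) : z (highStrand i) = y i := by
    simp only [z, dif_neg (highStrand_ne_zero i)]
    rfl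
  have hrow (i : Fin (n - 1)) : ((1 - burauWord (1 : Kˣ) v) *ᵥ z) (highStrand i) = 0 := by
    rw [mulVec, dotProduct, sum_univ_highStrand, hz0, mul_zero, zero_add]
    simp only [hzs]
    exact congrFun hy i
  have hz : (1 - burauWord (1 : Kˣ) v) *ᵥ z = 0 := by
    ext p
    by_cases hp : p = 0
    · subst hp
      have h0 : (fun p : Fin n => (((1 : Kˣ) : K)) ^ (p : ℕ)) ⬝ᵥ ((1 - burauWord (1 : Kˣ) v) *ᵥ z) =
          0 := by
        rw [dotProduct_mulVec, vecMul_sub, vecMul_one, vecMul_burauWord, sub_self, zero_dotProduct]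
      rw [dotProduct, sum_univ_highStrand] at h0
      simpa [hrow] using h0
    · have : p = highStrand ⟨p - 1, by have := Fin.val_ne_zero_iff.2 hp; omega⟩ := by
        have := Fin.val_ne_zero_iff.2 hp
        ext
        simp [highStrand]
        omega
      rw [this, hrow, Pi.zero_apply]
  rw [sub_mulVec, one_mulVec, sub_eq_zero] at hz
  ext i
  rw [← hzs, eq_of_isKnot v hK z hz.symm (highStrand i) 0, hz0, Pi.zero_apply]

/-- The Alexander polynomial of a knot takes the value `±1` at `t = 1`. -/
lemma isUnit_burauMinor_one [NeZero n] (v : BraidWord n) (hK : v.closure.IsKnot) :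
    IsUnit (burauMinor (1 : ℤˣ) v) := by
  by_contra h
  rw [Int.isUnit_iff_natAbs_eq] at h
  -- A non-unit integer, including 0, vanishes modulo some prime, which the field case forbids.
  obtain ⟨p, hp, hdvd⟩ := Nat.exists_prime_and_dvd h
  have : Fact p.Prime := ⟨hp⟩
  have h0 := (ZMod.intCast_zmod_eq_zero_iff_dvd _ p).2 (Int.natCast_dvd.2 hdvd)
  have h1 := burauMinor_map (Int.castRingHom (ZMod p)) (1 : ℤˣ) v
  rw [map_one, eq_intCast, h0] at h1
  exact burauMinor_one_ne_zero v hK h1.symm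

end KnotNormalization

/-! ### The braids `(w w*)^j`: symmetries, isometry and the square root. -/

section Amphicheiral

open Matrix

lemma isIntegrallyClosed_laurentPolynomial : IsIntegrallyClosed ℤ[T;T⁻¹] :=
  isIntegrallyClosed_of_isLocalization ℤ[T;T⁻¹] (Submonoid.powers (Polynomial.X : ℤ[X]))
    (Submonoid.powers_le.2 (mem_nonZeroDivisors_of_ne_zero Polynomial.X_ne_zero))

lemma mirror_mirror {n : ℕ} (w : BraidGroup n) : BraidGroup.mirror (BraidGroup.mirror w) = w := by
  have h (i : Fin (n - 1)) : BraidGroup.mirror (.of i : BraidGroup n) = (BraidGroup.σ i)⁻¹ :=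
    PresentedGroup.toGroup.of _
  have : (BraidGroup.mirror (n := n)).comp BraidGroup.mirror = MonoidHom.id _ := by
    refine PresentedGroup.ext fun i => ?_
    rw [MonoidHom.comp_apply, h, map_inv, BraidGroup.σ, h, inv_inv]
    rfl
  exact congrArg (fun g => g w) this

/-- The mirror image of `w w*` is `w* w`, which is `w w*` conjugated by `w`. -/
lemma mirror_mul_mirror_pow {n : ℕ} (w : BraidGroup n) (j : ℕ) :
    BraidGroup.mirror ((w * BraidGroup.mirror w) ^ j) =
      w⁻¹ * (w * BraidGroup.mirror w) ^ j * w := by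
  rw [map_pow, map_mul, mirror_mirror]
  have := conj_pow (i := j) (a := w⁻¹) (b := w * BraidGroup.mirror w)
  rw [inv_inv] at this
  rw [← this]
  congr 1
  group

variable {n : ℕ}

/-- The reduced Burau matrix over `ℤ[s, s⁻¹]`. -/
noncomputable abbrev burauMatrix (w : BraidGroup n) : Matrix (Fin (n - 1)) (Fin (n - 1)) ℤ[T;T⁻¹] :=
  (burau n laurentVar w).val

lemma charpoly_burauMatrix_map_laurentNeg (u : BraidGroup n) :
    (burauMatrix u).charpoly.map laurentNeg = (burauMatrix u).charpoly := by
  rw [← charpoly_map, burau_map, map_laurentNeg_laurentVar, burau_neg, Units.val_mul, Units.val_mul,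
    coe_units_inv, charpoly_units_conj]

lemma charpoly_burauMatrix_map_laurentBar {u g : BraidGroup n}
    (hu : BraidGroup.mirror u = g⁻¹ * u * g) :
    (burauMatrix u).charpoly.map laurentBar = (burauMatrix u).charpoly := by
  rw [← charpoly_map, burau_map, map_laurentBar_laurentVar, ← burau_mirror, hu, map_mul, map_mul,
    map_inv, Units.val_mul, Units.val_mul, coe_units_inv, charpoly_units_conj']

lemma exists_map_eq_charpoly_burauMatrix {u g : BraidGroup n}
    (hu : BraidGroup.mirror u = g⁻¹ * u * g) :
    ∃ P : ℤ[X][X], P.map substConwaySq = (burauMatrix u).charpoly := by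
  have h : (burauMatrix u).charpoly ∈ Polynomial.lifts substConwaySq := by
    rw [Polynomial.lifts_iff_coeff_lifts]
    intro i
    refine mem_range_substConwaySq ?_ ?_
    · rw [← Polynomial.coeff_map, charpoly_burauMatrix_map_laurentBar hu]
    · rw [← Polynomial.coeff_map, charpoly_burauMatrix_map_laurentNeg]
  exact (Polynomial.mem_lifts _).1 h

lemma det_one_sub_eq_eval_charpoly {R ι : Type*} [CommRing R] [Fintype ι] [DecidableEq ι]
    (M : Matrix ι ι R) : (1 - M).det = M.charpoly.eval 1 := by
  rw [eval_charpoly, map_one]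

lemma det_one_add_eq_eval_charpoly {R ι : Type*} [CommRing R] [Fintype ι] [DecidableEq ι]
    (hι : Even (Fintype.card ι)) (M : Matrix ι ι R) : (1 + M).det = M.charpoly.eval (-1) := by
  rw [eval_charpoly, map_neg, map_one, ← neg_add', det_neg, hι.neg_one_pow, one_mul]

lemma det_burauForm_ne_zero (n : ℕ) : (burauForm (n - 1) laurentVar).det ≠ 0 := by
  rw [det_burauForm]
  exact quantumInt_laurentVar_ne_zero (by omega)

/-- Since `ψ_{1/s}(w) = ψ_s(w*)`, the transposed isometry relation reads `ψ(w*)ᵀ J ψ(w) = J`;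
multiply by `ψ(w*)` on the right. -/
lemma transpose_burauForm_mul_mirror (w : BraidGroup n) :
    (burauForm (n - 1) laurentVar * burauMatrix (BraidGroup.mirror w))ᵀ *
      burauMatrix (w * BraidGroup.mirror w) =
        burauForm (n - 1) laurentVar * burauMatrix (BraidGroup.mirror w) := by
  have h := congrArg transpose (burau_isometry laurentVar w)
  rw [transpose_mul, transpose_mul, transpose_transpose, burauForm_transpose] at h
  rw [transpose_mul, burauForm_transpose, burauMatrix, burauMatrix, map_mul, Units.val_mul,
    burau_mirror, ← mul_assoc, mul_assoc _ (burauForm _ _), h]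

/-- From `Aᵀ M = A`, and its transpose `Mᵀ A = Aᵀ`, one gets `Mᵀ A M = Aᵀ M = A`. -/
lemma burauMatrix_isometry (w : BraidGroup n) :
    (burauMatrix (w * BraidGroup.mirror w))ᵀ *
      (burauForm (n - 1) laurentVar * burauMatrix (BraidGroup.mirror w)) *
        burauMatrix (w * BraidGroup.mirror w) =
          burauForm (n - 1) laurentVar * burauMatrix (BraidGroup.mirror w) := by
  have h := transpose_burauForm_mul_mirror w
  have h' := congrArg transpose h
  rw [transpose_mul, transpose_transpose] at h'
  rw [h', h]

lemma det_burauMatrix_mul_mirror (w : BraidGroup n) :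
    (burauMatrix (w * BraidGroup.mirror w)).det = 1 := by
  have h := congrArg det (burau_isometry laurentVar w)
  rw [det_mul, det_mul, det_transpose, mul_right_comm] at h
  rw [burauMatrix, map_mul, Units.val_mul, det_mul, burau_mirror]
  exact (mul_eq_right₀ (det_burauForm_ne_zero n)).1 h

/-- The characteristic polynomial is descended to coefficients in `ℤ[z²]` before its palindromy is
used, so that `b` and `r` are polynomials in `z²` too. -/
lemma exists_charpoly_eq {h : ℕ} (hn : n = 2 * h + 1) (w : BraidGroup n) (j : ℕ) :
    ∃ P : ℤ[X][X], P.map substConwaySq =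
      (burauMatrix ((w * BraidGroup.mirror w) ^ j)).charpoly ∧
      (∃ (b : ℤ[X]) (Q : ℤ[X][X]), P = Polynomial.C b * Polynomial.X ^ h +
        (Polynomial.X ^ 2 + 1) * Q) ∧
      ∃ r : ℤ[X], P.eval 1 = (-1) ^ h * P.eval (-1) + 4 * r := by
  obtain ⟨P, hP⟩ := exists_map_eq_charpoly_burauMatrix (mirror_mul_mirror_pow w j)
  have hcard : Fintype.card (Fin (n - 1)) = 2 * h := by simp [hn]
  refine ⟨P, hP, exists_eq_of_palindromic h P ?_ fun a b hab => ?_⟩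
  · rw [← Polynomial.natDegree_map_eq_of_injective substConwaySq_injective, hP,
      charpoly_natDegree_eq_dim, hcard]
  · apply substConwaySq_injective
    rw [← Polynomial.coeff_map, ← Polynomial.coeff_map, hP]
    have e : burauMatrix ((w * BraidGroup.mirror w) ^ j) =
        burauMatrix (w * BraidGroup.mirror w) ^ j := by
      rw [burauMatrix, map_pow, Units.val_pow_eq_pow_val]
    rw [e]
    refine charpoly_coeff_palindromic_of_isometry hcard (isometry_pow (burauMatrix_isometry w) j)
      ?_ ?_ a b hab
    · rw [det_mul]
      refine mul_ne_zero (det_burauForm_ne_zero n) ?_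
      exact ((isUnit_iff_isUnit_det _).1 (burau n laurentVar _).isUnit).ne_zero
    · rw [det_pow, det_burauMatrix_mul_mirror, one_pow]

/-- The Alexander polynomial of the closure of a braid, normalized by a power of `s`. -/
noncomputable def normalizedMinor (v : BraidWord n) : ℤ[T;T⁻¹] :=
  (laurentVar : ℤ[T;T⁻¹]) ^ (n - 1) * burauMinor (laurentVar ^ 2) v

lemma det_one_sub_burauMatrix [NeZero n] (v : BraidWord n) :
    (1 - burauMatrix v.toBraid).det = quantumInt laurentVar n * normalizedMinor v := by
  rw [burauMatrix, det_one_sub_burau, ← pow_mul_quantumInt, normalizedMinor]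
  ring

lemma laurentEvalOne_normalizedMinor (v : BraidWord n) :
    laurentEvalOne (normalizedMinor v) = burauMinor (1 : ℤˣ) v := by
  have h1 : laurentEvalOne (laurentVar : ℤ[T;T⁻¹]) = 1 :=
    congrArg Units.val map_laurentEvalOne_laurentVar
  rw [normalizedMinor, map_mul, map_pow, h1, burauMinor_map, map_pow,
    map_laurentEvalOne_laurentVar, one_pow, one_pow, one_mul]

lemma substSq_T (j : ℤ) : substSq (LaurentPolynomial.T j) = LaurentPolynomial.T (2 * j) := by
  rw [substSq, LaurentPolynomial.eval₂_T]
  exact LaurentPolynomial.coe_unit_T_zpow 2 j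

/-- The diagram uses `T 1` as `t`, the representation as `s`. For odd `n` the normalizing power
`s^(n-1)` is the unit `t^h`, so the normalized minor is an Alexander polynomial at `t = s²`. -/
lemma normalizedMinor_eq_substSq {h : ℕ} (hn : n = 2 * h + 1) (v : BraidWord n) :
    normalizedMinor v = substSq (LaurentPolynomial.T h * burauMinor laurentVar v) := by
  have h1 : Units.map (substSq : ℤ[T;T⁻¹] →* ℤ[T;T⁻¹]) laurentVar = laurentVar ^ 2 := by
    ext1
    change substSq (LaurentPolynomial.T 1) = LaurentPolynomial.T 1 ^ 2
    rw [substSq_T, LaurentPolynomial.T_pow]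
    rfl
  rw [map_mul, substSq_T, burauMinor_map, h1, normalizedMinor, laurentVar_val,
    LaurentPolynomial.T_pow, show ((n - 1 : ℕ) : ℤ) * 1 = 2 * h by omega]

lemma laurentBar_substConwaySq (P : ℤ[X]) : laurentBar (substConwaySq P) = substConwaySq P := by
  have : laurentBar.comp substConwaySq = substConwaySq := by
    refine Polynomial.ringHom_ext (by simp) ?_
    rw [RingHom.comp_apply, substConwaySq_X, map_pow, map_sub, laurentBar_apply, laurentBar_apply,
      LaurentPolynomial.invert_T, LaurentPolynomial.invert_T, neg_neg]
    ring
  exact congrArg (fun f => f P) this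

lemma laurentNeg_substConwaySq (P : ℤ[X]) : laurentNeg (substConwaySq P) = substConwaySq P := by
  have : laurentNeg.comp substConwaySq = substConwaySq := by
    refine Polynomial.ringHom_ext (by simp) ?_
    rw [RingHom.comp_apply, substConwaySq_X, map_pow, map_sub, laurentNeg_T, laurentNeg_T, zpow_one,
      _root_.zpow_neg, zpow_one, inv_neg_one, Units.neg_smul, Units.neg_smul, one_smul, one_smul]
    ring
  exact congrArg (fun f => f P) this

/-- Both `[n]` and its product with the normalized minor are invariant under the two involutions,
and `[n]` can be cancelled. -/
lemma normalizedMinor_mem_range {h : ℕ} (hn : n = 2 * h + 1) {v : BraidWord n} {P : ℤ[X][X]}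
    (hP : P.map substConwaySq = (burauMatrix v.toBraid).charpoly) :
    ∃ C, substConwaySq C = normalizedMinor v := by
  have : NeZero n := ⟨by omega⟩
  have h1 : quantumInt laurentVar n * normalizedMinor v = substConwaySq (P.eval 1) := by
    rw [← det_one_sub_burauMatrix, det_one_sub_eq_eval_charpoly, ← hP, ← Polynomial.eval_map_apply,
      map_one]
  have hne := quantumInt_laurentVar_ne_zero (n := n) (by omega)
  obtain ⟨q, hq⟩ : quantumInt laurentVar n ∈ substConwaySq.range := by
    rw [hn]
    exact quantumInt_laurentVar_mem_range h
  refine mem_range_substConwaySq ?_ ?_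
  · apply mul_left_cancel₀ hne
    have := congrArg laurentBar h1
    rwa [map_mul, ← hq, laurentBar_substConwaySq, laurentBar_substConwaySq, ← h1, hq] at this
  · apply mul_left_cancel₀ hne
    have := congrArg laurentNeg h1
    rwa [map_mul, ← hq, laurentNeg_substConwaySq, laurentNeg_substConwaySq, ← h1, hq] at this

/-- Take determinants in `Aᵀ (1 - M) = Aᵀ - A`: up to sign, `[n]² s^(2e)` times the normalized minor
is a skew-symmetric determinant of even size. Its square root exists in the fraction field and
returns to `ℤ[s, s⁻¹]` because this ring is integrally closed. -/
lemma exists_sq_eq_normalizedMinor {h : ℕ} (hn : n = 2 * h + 1) {v : BraidWord n}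
    {w : BraidGroup n} (hv : v.toBraid = w * BraidGroup.mirror w) :
    ∃ (g : ℤ[T;T⁻¹]) (ε : ℤˣ), g ^ 2 = LaurentPolynomial.C (ε : ℤ) * normalizedMinor v := by
  have : NeZero n := ⟨by omega⟩
  have hic := isIntegrallyClosed_laurentPolynomial
  set K := FractionRing ℤ[T;T⁻¹]
  set ι := algebraMap ℤ[T;T⁻¹] K
  have hι : Function.Injective ι := IsFractionRing.injective _ _
  set Φ := burauForm (n - 1) laurentVar * burauMatrix (BraidGroup.mirror w)
  have h1 : Φ.det * (quantumInt laurentVar n * normalizedMinor v) = (Φᵀ - Φ).det := by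
    rw [← det_one_sub_burauMatrix, ← det_transpose Φ, ← det_mul, mul_sub, mul_one, hv,
      transpose_burauForm_mul_mirror]
  obtain ⟨x, hx⟩ : ∃ x, ((Φᵀ - Φ).map ι).det = x ^ 2 := by
    refine exists_det_eq_sq_of_transpose_eq_neg ?_ h _ (by simp [hn]) ?_
    · rw [← map_ofNat ι 2]
      exact (map_ne_zero_iff ι hι).2 (by
        intro h2
        have := congrArg laurentEvalOne h2
        rw [map_ofNat, map_zero] at this
        exact absurd this (by norm_num))
    · ext i j
      simp
  obtain ⟨e, he⟩ := exists_det_burau laurentVar (BraidGroup.mirror w)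
  have hne : ι (quantumInt laurentVar n) ≠ 0 :=
    (map_ne_zero_iff ι hι).2 (quantumInt_laurentVar_ne_zero (by omega))
  obtain ⟨ε, hε⟩ : ∃ ε : ℤˣ, ((-laurentVar ^ 2 : ℤ[T;T⁻¹]ˣ) ^ e : ℤ[T;T⁻¹]ˣ) =
      LaurentPolynomial.C (ε : ℤ) * ((laurentVar ^ e : ℤ[T;T⁻¹]ˣ) : ℤ[T;T⁻¹]) ^ 2 := by
    refine ⟨(-1) ^ e, ?_⟩
    have h1 : (-laurentVar ^ 2 : ℤ[T;T⁻¹]ˣ) ^ e = (-1) ^ e * (laurentVar ^ e) ^ 2 := by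
      rw [← neg_one_mul, mul_zpow, ← zpow_natCast, ← zpow_natCast, zpow_comm]
    rw [h1, Units.val_mul, Units.val_pow_eq_pow_val]
    rcases Int.even_or_odd e with h | h <;> simp [h.neg_one_zpow]
  have hu : ι ((laurentVar ^ e : ℤ[T;T⁻¹]ˣ) : ℤ[T;T⁻¹]) ≠ 0 :=
    (map_ne_zero_iff ι hι).2 (Units.ne_zero _)
  have h2 : (x / (ι (quantumInt laurentVar n) * ι ((laurentVar ^ e : ℤ[T;T⁻¹]ˣ) : ℤ[T;T⁻¹]))) ^ 2 =
      ι (LaurentPolynomial.C (ε : ℤ) * normalizedMinor v) := by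
    have h3 : Φ.det = quantumInt laurentVar n * (LaurentPolynomial.C (ε : ℤ) *
        ((laurentVar ^ e : ℤ[T;T⁻¹]ˣ) : ℤ[T;T⁻¹]) ^ 2) := by
      rw [det_mul, he, hε, det_burauForm, Nat.sub_add_cancel (by omega)]
    rw [div_pow, ← hx, ← RingHom.mapMatrix_apply, ← RingHom.map_det, ← h1, h3,
      div_eq_iff (pow_ne_zero 2 (mul_ne_zero hne hu))]
    simp only [map_mul, map_pow]
    ring
  obtain ⟨g, hg⟩ := IsIntegrallyClosed.exists_algebraMap_eq_of_isIntegral_pow (R := ℤ[T;T⁻¹])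
    (n := 2) two_pos (by rw [h2]; exact isIntegral_algebraMap)
  refine ⟨g, ε, hι ?_⟩
  rw [map_pow, ← h2, ← hg]

lemma laurent_ringHom_ext {S : Type*} [CommRing S] {f g : ℤ[T;T⁻¹] →+* S}
    (h : f (LaurentPolynomial.T 1) = g (LaurentPolynomial.T 1)) : f = g := by
  refine IsLocalization.ringHom_ext (Submonoid.powers (Polynomial.X : ℤ[X])) ?_
  refine Polynomial.ringHom_ext (by simp) ?_
  simpa [LaurentPolynomial.algebraMap_eq_toLaurent] using h

/-- Each involution sends `g` to `±g`. The sign `-` would make `g` vanish at `s = 1`, respectively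
at `s = i`, contradicting that `C(0)` is a unit. -/
lemma exists_substConwaySq_eq_of_sq_eq {g : ℤ[T;T⁻¹]} {C : ℤ[X]} (hg : g ^ 2 = substConwaySq C)
    (hC : IsUnit (C.eval 0)) : ∃ F, substConwaySq F = g := by
  have hbar : laurentBar g = g := by
    have h1 : laurentBar g ^ 2 = g ^ 2 := by rw [← map_pow, hg, laurentBar_substConwaySq]
    refine (sq_eq_sq_iff_eq_or_eq_neg.1 h1).resolve_right fun h => ?_
    have h2 : laurentEvalOne (laurentBar g) = laurentEvalOne g := by
      have : laurentEvalOne.comp laurentBar = laurentEvalOne := by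
        apply laurent_ringHom_ext
        rw [RingHom.comp_apply, laurentBar_apply, LaurentPolynomial.invert_T]
        simp [laurentEvalOne]
      exact congrArg (fun f => f g) this
    have h3 : laurentEvalOne g = 0 := by
      rw [h, map_neg] at h2
      omega
    have h4 := congrArg laurentEvalOne hg
    rw [map_pow, h3, laurentEvalOne_substConwaySq] at h4
    rw [← h4] at hC
    exact absurd hC (by simp)
  have hneg : laurentNeg g = g := by
    have h1 : laurentNeg g ^ 2 = g ^ 2 := by rw [← map_pow, hg, laurentNeg_substConwaySq]
    refine (sq_eq_sq_iff_eq_or_eq_neg.1 h1).resolve_right fun h => ?_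
    -- At `s = i` the two involutions agree, since `i⁻¹ = -i`, and `z² = (2i)² = -4`.
    let f : ℤ[T;T⁻¹] →+* ℂ :=
      LaurentPolynomial.eval₂ (Int.castRingHom ℂ) (Units.mk0 Complex.I Complex.I_ne_zero)
    have h2 : f (laurentBar g) = f (laurentNeg g) := by
      have : f.comp laurentBar = f.comp laurentNeg := by
        apply laurent_ringHom_ext
        rw [RingHom.comp_apply, RingHom.comp_apply, laurentBar_apply, LaurentPolynomial.invert_T,
          laurentNeg_T]
        simp [f]
      exact congrArg (fun f => f g) this
    have h3 : f g = 0 := by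
      rw [h, hbar, map_neg] at h2
      exact self_eq_neg.1 h2
    have h4 : f.comp substConwaySq = (Int.castRingHom ℂ).comp (Polynomial.evalRingHom (-4)) := by
      refine Polynomial.ringHom_ext (by simp) ?_
      rw [RingHom.comp_apply, substConwaySq_X]
      simp only [f, map_pow, map_sub, LaurentPolynomial.eval₂_T]
      simp only [zpow_one, _root_.zpow_neg, Units.val_mk0, Units.val_inv_eq_inv_val, Complex.inv_I,
        RingHom.comp_apply, Polynomial.coe_evalRingHom, Polynomial.eval_X, sub_neg_eq_add]
      rw [← two_mul, mul_pow, Complex.I_sq]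
      norm_num
    have h5 : ((C.eval (-4) : ℤ) : ℂ) = 0 := by
      have := congrArg (fun f => f C) h4
      simp only [RingHom.comp_apply, ← hg, map_pow, h3] at this
      simpa using this.symm
    have h6 : C.eval (-4) = 0 := by exact_mod_cast h5
    -- A zero at `-4` forces 4 to divide the unit `C(0)`.
    have h7 := Polynomial.sub_dvd_eval_sub (-4) 0 C
    rw [h6, zero_sub, sub_zero, dvd_neg] at h7
    have := isUnit_of_dvd_unit h7 hC
    rw [Int.isUnit_iff] at this
    omega
  exact mem_range_substConwaySq hbar hneg

end Amphicheiral

/-! ### The Conway polynomial modulo 4. -/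

section ConwayPolynomial

open Matrix

variable {n : ℕ}

lemma isConwayPolynomial_closure {h : ℕ} (hn : n = 2 * h + 1) {v : BraidWord n} {C' : ℤ[X]}
    (hC : substConwaySq C' = normalizedMinor v) {δ : ℤˣ} (hδ : C'.eval 0 = δ) :
    v.closure.IsConwayPolynomial (Polynomial.C (δ : ℤ) * Polynomial.expand ℤ 2 C') := by
  have : NeZero n := ⟨by omega⟩
  refine ⟨⟨LaurentPolynomial.C (δ : ℤ) * (LaurentPolynomial.T h * burauMinor laurentVar v), ?_, ?_⟩,
    ?_⟩
  · rw [LinkDiagram.IsAlexanderPolynomial, alexanderIdeal_closure, ← mul_assoc, mul_comm]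
    refine (Ideal.span_singleton_mul_right_unit ?_ _).symm
    exact (δ.isUnit.map LaurentPolynomial.C).mul (LaurentPolynomial.isUnit_T _)
  · rw [map_mul, map_mul, ← normalizedMinor_eq_substSq hn, ← hC, substConwaySq_apply]
    simp [substConway]
  · rw [Polynomial.eval_mul, Polynomial.eval_C, Polynomial.expand_eval, zero_pow two_ne_zero, hδ,
      ← Units.val_mul, Int.units_mul_self, Units.val_one]

/-- If the Conway polynomial, as a polynomial in `z²`, is `±(a² - z² b²)` modulo `4`, then it is
`f(z) f(-z)` modulo `4`. -/
lemma exists_conway_eq_mul_comp_neg {h : ℕ} (hn : n = 2 * h + 1) {v : BraidWord n} {C' : ℤ[X]}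
    (hC : substConwaySq C' = normalizedMinor v) (hunit : IsUnit (C'.eval 0)) (ε : ℤˣ)
    (a b r : ℤ[X])
    (h4 : C' = Polynomial.C (ε : ℤ) * (a ^ 2 - Polynomial.X * b ^ 2) + 4 * r) :
    ∃ C : ℤ[X], v.closure.IsConwayPolynomial C ∧ ∃ f : (ZMod 4)[X],
      C.map (Int.castRingHom (ZMod 4)) = f * f.comp (-Polynomial.X) := by
  obtain ⟨δ, hδ⟩ := hunit
  have hconway := isConwayPolynomial_closure hn hC hδ.symm
  refine ⟨_, hconway, ?_⟩
  set φ : ℤ[X] →+* (ZMod 4)[X] := Polynomial.mapRingHom (Int.castRingHom (ZMod 4))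
  set A := Polynomial.expand (ZMod 4) 2 (φ a) with hA
  set B := Polynomial.expand (ZMod 4) 2 (φ b) with hB
  have hcomp (P : (ZMod 4)[X]) :
      (Polynomial.expand (ZMod 4) 2 P).comp (-Polynomial.X) = Polynomial.expand (ZMod 4) 2 P := by
    rw [Polynomial.expand_eq_comp_X_pow, Polynomial.comp_assoc, Polynomial.X_pow_comp, neg_sq]
  have hC4 : (Polynomial.C (δ : ℤ) * Polynomial.expand ℤ 2 C').map (Int.castRingHom (ZMod 4)) =
      Polynomial.C ((δ * ε : ℤ) : ZMod 4) * (A ^ 2 - Polynomial.X ^ 2 * B ^ 2) := by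
    rw [Polynomial.map_mul, Polynomial.map_C, Polynomial.map_expand]
    have : C'.map (Int.castRingHom (ZMod 4)) =
        Polynomial.C ((ε : ℤ) : ZMod 4) * (φ a ^ 2 - Polynomial.X * φ b ^ 2) := by
      have h0 : φ 4 = 0 := by
        rw [show (4 : ℤ[X]) = Polynomial.C 4 by simp, Polynomial.coe_mapRingHom, Polynomial.map_C]
        rw [show Int.castRingHom (ZMod 4) 4 = 0 from by decide, map_zero]
      change φ C' = _
      rw [h4, map_add, map_mul, map_mul φ 4 r, h0, zero_mul, add_zero, map_sub, map_pow, map_mul,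
        map_pow]
      simp [φ]
    rw [this]
    simp [hA, hB, mul_assoc]
  -- At `z = 0` the identity says that 1 is `±` a square modulo 4, which excludes the sign `-`.
  have hsign : ((δ * ε : ℤ) : ZMod 4) = 1 := by
    have h1 := congrArg (Polynomial.eval 0) hC4
    rw [Polynomial.eval_zero_map, hconway.2] at h1
    simp only [Polynomial.eval_mul, Polynomial.eval_C, Polynomial.eval_sub, Polynomial.eval_pow,
      Polynomial.eval_X, map_one] at h1
    have h2 : (δ * ε : ℤ) = 1 ∨ (δ * ε : ℤ) = -1 := by
      rw [← Units.val_mul]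
      exact Int.isUnit_iff.1 (δ * ε).isUnit
    rcases h2 with h2 | h2
    · rw [h2, Int.cast_one]
    · rw [h2] at h1
      exfalso
      generalize Polynomial.eval 0 A = x at h1
      generalize Polynomial.eval 0 B = y at h1
      revert x y
      decide
  -- `A` and `B` are even in `z`, so `f(z) f(-z) = A² - z² B²`.
  refine ⟨A + Polynomial.X * B, ?_⟩
  rw [hC4, hsign, Polynomial.add_comp, Polynomial.mul_comp, Polynomial.X_comp, hcomp, hcomp, map_one]
  ring

lemma isUnit_eval_zero {h : ℕ} (hn : n = 2 * h + 1) {v : BraidWord n} (hK : v.closure.IsKnot)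
    {C' : ℤ[X]} (hC : substConwaySq C' = normalizedMinor v) : IsUnit (C'.eval 0) := by
  have : NeZero n := ⟨by omega⟩
  rw [← laurentEvalOne_substConwaySq, hC, laurentEvalOne_normalizedMinor]
  exact isUnit_burauMinor_one v hK

lemma exists_toBraid_eq (w : BraidGroup n) : ∃ v : BraidWord n, v.toBraid = w := by
  obtain ⟨x, rfl⟩ := PresentedGroup.mk_surjective _ w
  exact ⟨x.toWord, by rw [BraidWord.toBraid, FreeGroup.mk_toWord]⟩

/-- The part of the determinant of `1 - M ^ 2 ^ (m + 1)` that does not come from `1 - M ^ 2` is a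
square. -/
lemma exists_prod_eq_sq {h : ℕ} (hn : n = 2 * h + 1) (w : BraidGroup n) (m : ℕ) :
    ∃ b : ℤ[X], ∏ k ∈ Finset.range m,
      (1 + burauMatrix (w * BraidGroup.mirror w) ^ 2 ^ (k + 1)).det = substConwaySq (b ^ 2) := by
  have key (k : ℕ) : ∃ b : ℤ[X],
      (1 + burauMatrix (w * BraidGroup.mirror w) ^ 2 ^ (k + 1)).det = substConwaySq (b ^ 2) := by
    obtain ⟨P, hP, ⟨b, Q, hbQ⟩, -⟩ := exists_charpoly_eq hn w (2 ^ k)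
    refine ⟨b, ?_⟩
    rw [map_pow, ← det_one_add_sq_of_charpoly (h := h) 
      (burauMatrix ((w * BraidGroup.mirror w) ^ 2 ^ k)) _ (Q.map substConwaySq)]
    · rw [pow_succ, pow_mul]
      rw [burauMatrix, burauMatrix, map_pow, Units.val_pow_eq_pow_val]
    · rw [← hP, hbQ]
      simp
  choose b hb using key
  refine ⟨∏ k ∈ Finset.range m, b k, ?_⟩
  rw [← Finset.prod_pow, map_prod]
  exact Finset.prod_congr rfl fun k _ => hb k

end ConwayPolynomial

theorem theorem3 (n : ℕ) (hn : Odd n) (w : BraidGroup n) (m : ℕ) (v : BraidWord n)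
    (hv : v.toBraid = (w * BraidGroup.mirror w) ^ (2 ^ m)) (hK : v.closure.IsKnot) :
    ∃ C : Polynomial ℤ, v.closure.IsConwayPolynomial C ∧
      ∃ f : Polynomial (ZMod 4),
        C.map (Int.castRingHom (ZMod 4)) = f * f.comp (-Polynomial.X) := by
  obtain ⟨h, hn⟩ := hn
  have : NeZero n := ⟨by omega⟩
  obtain ⟨Pm, hPm, -⟩ := exists_charpoly_eq hn w (2 ^ m)
  rw [← hv] at hPm
  obtain ⟨C', hC'⟩ := normalizedMinor_mem_range hn hPm
  have hunit := isUnit_eval_zero hn hK hC'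
  have hε2 (ε : ℤˣ) : Polynomial.C (ε : ℤ) * Polynomial.C (ε : ℤ) = 1 := by
    rw [← map_mul, ← Units.val_mul, Int.units_mul_self, Units.val_one, map_one]
  rcases m with _ | m
  -- For `m = 0` the polynomial is exactly `±F²`, so `b = 0` and no error term is needed.
  · rw [pow_zero, pow_one] at hv
    obtain ⟨g, ε, hg⟩ := exists_sq_eq_normalizedMinor hn hv
    have hg' : g ^ 2 = substConwaySq (Polynomial.C (ε : ℤ) * C') := by
      rw [hg, map_mul, substConwaySq_C, hC']
    obtain ⟨F, hF⟩ := exists_substConwaySq_eq_of_sq_eq hg' (by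
      rw [Polynomial.eval_mul, Polynomial.eval_C]
      exact ε.isUnit.mul hunit)
    have h1 : F ^ 2 = Polynomial.C (ε : ℤ) * C' := by
      apply substConwaySq_injective
      rw [map_pow, hF, hg']
    refine exists_conway_eq_mul_comp_neg hn hC' hunit ε F 0 0 ?_
    linear_combination (-Polynomial.C (ε : ℤ)) * h1 - C' * hε2 ε
  · set u := w * BraidGroup.mirror w with hu
    obtain ⟨v₀, hv₀⟩ := exists_toBraid_eq u
    obtain ⟨P, hP, -, r, hr⟩ := exists_charpoly_eq hn w 1
    rw [pow_one, ← hu] at hP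
    obtain ⟨C₀, hC₀⟩ := normalizedMinor_mem_range hn (v := v₀) (by rw [hv₀, hP])
    obtain ⟨a, b, ε, hab⟩ := exists_quantumInt_eq h
    obtain ⟨B, hB⟩ := exists_prod_eq_sq hn w m
    rw [← hn] at hab
    set q := Polynomial.C (ε : ℤ) * (a ^ 2 - (Polynomial.X + 4) * b ^ 2) with hq
    have hq0 : q ≠ 0 := by
      rintro h0
      rw [h0, map_zero] at hab
      exact quantumInt_laurentVar_ne_zero (by omega) hab
    have hP1 : P.eval 1 = q * C₀ := by
      apply substConwaySq_injective
      rw [map_mul, ← hab, hC₀, ← det_one_sub_burauMatrix, hv₀, det_one_sub_eq_eval_charpoly, ← hP,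
        ← Polynomial.eval_map_apply, map_one]
    have hPm1 : (1 + burauMatrix u).det = substConwaySq (P.eval (-1)) := by
      rw [det_one_add_eq_eval_charpoly (by simp [hn]), ← hP, ← Polynomial.eval_map_apply, map_neg,
        map_one]
    -- The factorization of `det (1 - M^(2^(m+1)))` with the common factor `[n]` cancelled.
    have hCm : C' = C₀ * P.eval (-1) * B ^ 2 := by
      apply mul_left_cancel₀ hq0
      apply substConwaySq_injective
      have e : burauMatrix v.toBraid = burauMatrix u ^ 2 ^ (m + 1) := by
        rw [hv, burauMatrix, map_pow, Units.val_pow_eq_pow_val]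
      rw [map_mul, ← hab, hC', ← det_one_sub_burauMatrix, e, det_one_sub_pow_two_pow,
        Finset.prod_range_succ', hB, pow_zero, pow_one, hPm1, det_one_sub_eq_eval_charpoly, ← hP,
        ← map_one substConwaySq, Polynomial.eval_map_apply, hP1]
      simp only [map_mul]
      ring
    have hsign : ((-1 : ℤ[X]) ^ h) * (-1) ^ h = 1 := by rw [← mul_pow]; simp
    -- Substitute `P(-1) = (-1)^h (q C₀ - 4 r)` and `q = ε (a² - X b² - 4 b²)`; the two terms with a
    -- factor 4 make up the remainder.
    refine exists_conway_eq_mul_comp_neg hn hC' hunit ((-1) ^ h * ε) (C₀ * B * a) (C₀ * B * b)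
      (-(-1) ^ h * C₀ * B ^ 2 * (r + C₀ * Polynomial.C (ε : ℤ) * b ^ 2)) ?_
    have hcast : Polynomial.C ((((-1) ^ h * ε : ℤˣ)) : ℤ) = (-1) ^ h * Polynomial.C (ε : ℤ) := by
      simp
    rw [hP1] at hr
    rw [hCm, hcast]
    linear_combination (-(C₀ * B ^ 2) * Polynomial.eval (-1) P) * hsign
      - (-1) ^ h * C₀ * B ^ 2 * hr
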